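/- Let $k=(k_1,\dots,k_l)$ be positive integers, $n=k_1+\dots+k_l$, and write $z\in\mathbb{C}^n$ in blocks $z=(z_{(1)},\dots,z_{(l)})$ with $z_{(j)}\in\mathbb{C}^{k_j}$. Put $V_k=\prod_{j=1}^l(\mathbb{C}^{k_j}\setminus\{0\})$ and $$\pi_k:V_k\to\prod_{j=1}^l\mathbb{P}^{k_j-1}(\mathbb{C}),\qquad \pi_k(z)=([z_{(1)}],\dots,[z_{(l)}]).$$ The group $(\mathbb{C}^*)^n$ acts componentwise on $\mathbb{C}^n$ and on $V_k$, and blockwise on $\prod_j\mathbb{P}^{k_j-1}(\mathbb{C})$. Consider its subgroups $$A_k=\prod_{j=1}^l\mathbb{C}^*(1,\dots,1)\cong(\mathbb{C}^*)^l,\qquad T_k=\mathbb{T}^n\cap A_k,\qquad B_k=\prod_{j=1}^l\{b\in(\mathbb{C}^*)^{k_j}:b_1\cdots b_{k_j}=1\}.$$ Let $\mathbb{U}^n$ be either $\mathbb{C}^n\subset\mathbb{P}^n(\mathbb{C})$ with the Fubini–Study Kähler structure ($\varepsilon=1$) or the unit ball $\mathbb{B}^n$ with the complex hyperbolic Kähler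 structure ($\varepsilon=-1$), with Kähler form $$\omega=i\,\frac{(1+\varepsilon|z|^2)\sum_r dz_r\wedge d\bar z_r-\varepsilon\sum_{r,s}\bar z_r z_s\,dz_r\wedge d\bar z_s}{(1+\varepsilon|z|^2)^2}.$$ For $p\in\prod_j\mathbb{P}^{k_j-1}(\mathbb{C})$ let $F_p=\pi_k^{-1}(p)\cap\mathbb{U}^n$, let $\mathcal{O}_p$ be the foliation of $F_p$ by $T_k$-orbits, and let $\mathcal{F}_p$ be the foliation of $F_p$ that integrates the orthogonal complement of $T\mathcal{O}_p$ in $TF_p$. A Lagrangian frame on a Kähler manifold is a pair $(\mathcal{O},\mathcal{F})$ of smooth Lagrangian foliations that are orthogonal to each other, with $\mathcal{O}$ Riemannian (the metric is invariant under leaf holonomy) and $\mathcal{F}$ totally geodesic. Then: 1. $\pi_k:V_k\to\prod_j\mathbb{P}^{k_j-1}(\mathbb{C})$ is a holomorphic principal bundle with structure group $A_k$, and the actions of each $b\in B_k$ on $V_k$ and on $\prod_j\mathbb{P}^{k_j-1}(\mathbb{C})$ form an automorphism of this principal bundle: both are biholomorphic, the first commutes with the $A_k$-action, and $\pi_k(b\cdot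 z)=b\cdot\pi_k(z)$. 2. For both choices of $\mathbb{U}^n$, each fiber $F_p$ is a complex submanifold of dimension $l$ and $(\mathcal{O}_p,\mathcal{F}_p)$ is a Lagrangian frame of $F_p$ for the Kähler structure inherited from $\mathbb{U}^n$. The group $\mathbb{T}^n\cap B_k$ acts on $V_k\cap\mathbb{U}^n$ by isometries, and it permutes the fibers and their Lagrangian frames: each $b\in\mathbb{T}^n\cap B_k$ maps $F_p$ onto $F_{b\cdot p}$, each leaf of $\mathcal{O}_p$ onto a leaf of $\mathcal{O}_{b\cdot p}$, and each leaf of $\mathcal{F}_p$ onto a leaf of $\mathcal{F}_{b\cdot p}$. -/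

import Mathlib

open scoped Manifold ContDiff Topology LinearAlgebra.Projectivization

noncomputable section

/-! ### Complex projective space as a complex manifold -/

namespace ProjSpace

variable {m : ℕ}

/-- The quotient topology on `ℙ^{m-1}(ℂ) = (ℂ^m \ {0}) / ℂ*`. -/
instance instTopologicalSpace : TopologicalSpace (ℙ ℂ (Fin m → ℂ)) :=
  TopologicalSpace.coinduced (Projectivization.mk' ℂ) inferInstance

lemma isQuotientMap_mk' : Topology.IsQuotientMap
    (Projectivization.mk' ℂ : {v : Fin m → ℂ // v ≠ 0} → ℙ ℂ (Fin m → ℂ)) :=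
  ⟨⟨rfl⟩, Quotient.mk_surjective⟩

/-- The homogeneous coordinates of `p`, rescaled so that the `i`-th one is `1`; only meaningful
if the `i`-th homogeneous coordinate of `p` does not vanish. -/
def normalized (i : Fin m) (p : ℙ ℂ (Fin m → ℂ)) : Fin m → ℂ :=
  p.lift (fun v : {v : Fin m → ℂ // v ≠ 0} => (v.1 i)⁻¹ • v.1) (by
    rintro ⟨a, ha⟩ ⟨b, hb⟩ t (rfl : a = t • b)
    have ht : t ≠ 0 := by
      rintro rfl
      simp at ha
    ext c
    simp only [Pi.smul_apply, smul_eq_mul, mul_inv]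
    field_simp)

@[simp] lemma normalized_mk (i : Fin m) (v : Fin m → ℂ) (hv : v ≠ 0) :
    normalized i (Projectivization.mk ℂ v hv) = (v i)⁻¹ • v := rfl

/-- The increasing injection `Fin (m - 1) → Fin m` whose image misses `i`. -/
def skip (i : Fin m) (a : Fin (m - 1)) : Fin m :=
  ⟨if a.1 < i.1 then a.1 else a.1 + 1, by split_ifs <;> omega⟩

/-- The vector of `ℂ^m` with `i`-th coordinate `1` whose remaining coordinates are those of `w`,
in order. -/
def insertOne (i : Fin m) (w : Fin (m - 1) → ℂ) (c : Fin m) : ℂ :=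
  if c = i then 1
  else if h : c.1 < i.1 then w ⟨c.1, by omega⟩
  else if h' : i.1 < c.1 then w ⟨c.1 - 1, by omega⟩
  else 1

@[simp] lemma insertOne_self (i : Fin m) (w : Fin (m - 1) → ℂ) : insertOne i w i = 1 := by
  simp [insertOne]

lemma insertOne_ne_zero (i : Fin m) (w : Fin (m - 1) → ℂ) : insertOne i w ≠ 0 := fun h => by
  simpa using congrFun h i

@[simp] lemma insertOne_skip (i : Fin m) (w : Fin (m - 1) → ℂ) (a : Fin (m - 1)) :
    insertOne i w (skip i a) = w a := by
  unfold insertOne skip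
  by_cases h : a.1 < i.1
  · have h1 : (⟨a.1, by omega⟩ : Fin m) ≠ i := fun e => by simp [← e] at h
    simp [h, h1]
  · have h1 : (⟨a.1 + 1, by omega⟩ : Fin m) ≠ i := fun e => by simp [← e] at h
    have h2 : ¬ a.1 + 1 < i.1 := by omega
    have h3 : i.1 < a.1 + 1 := by omega
    simp [h, h1, h2, h3]

lemma insertOne_comp_skip (i : Fin m) (v : Fin m → ℂ) (hv : v i = 1) :
    insertOne i (fun a => v (skip i a)) = v := by
  ext c
  by_cases h : c = i
  · subst h; simp [hv]
  · have h0 : c.1 ≠ i.1 := fun e => h (Fin.ext e)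
    rcases lt_or_gt_of_ne h0 with h1 | h1
    · simp [insertOne, h, h1, skip]
    · have h2 : ¬ c.1 < i.1 := by omega
      have h3 : ¬ c.1 - 1 < i.1 := by omega
      have h4 : c.1 - 1 + 1 = c.1 := by omega
      simp [insertOne, h, h1, h2, h3, skip, h4]

lemma continuous_insertOne (i : Fin m) : Continuous (insertOne i) := by
  refine continuous_pi fun c => ?_
  unfold insertOne
  split_ifs <;> fun_prop

lemma isOpen_preimage_affine (i : Fin m) :
    IsOpen (Projectivization.mk' ℂ ⁻¹' {p : ℙ ℂ (Fin m → ℂ) | normalized i p i ≠ 0}) := by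
  have : Projectivization.mk' ℂ ⁻¹' {p : ℙ ℂ (Fin m → ℂ) | normalized i p i ≠ 0}
      = {v : {v : Fin m → ℂ // v ≠ 0} | v.1 i ≠ 0} := by
    ext v
    simp
  rw [this]
  exact isOpen_ne_fun ((continuous_apply _).comp continuous_subtype_val) continuous_const

/-- The `i`-th affine chart: it is defined where the `i`-th homogeneous coordinate does not vanish
and sends `[v]` to the quotients `v c / v i` for `c ≠ i`. -/
def affineChart (i : Fin m) : OpenPartialHomeomorph (ℙ ℂ (Fin m → ℂ)) (Fin (m - 1) → ℂ) where
  toFun p a := normalized i p (skip i a)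
  invFun w := Projectivization.mk ℂ (insertOne i w) (insertOne_ne_zero i w)
  source := {p | normalized i p i ≠ 0}
  target := Set.univ
  map_source' _ _ := trivial
  map_target' w _ := by simp
  left_inv' p hp := by
    induction p using Projectivization.ind with
    | h v hv =>
      have hvi : v i ≠ 0 := fun h => by simp [h] at hp
      rw [Projectivization.mk_eq_mk_iff']
      exact ⟨(v i)⁻¹, (insertOne_comp_skip _ _ (by simp [hvi])).symm⟩
  right_inv' w _ := by
    ext a
    simp
  open_source := isQuotientMap_mk'.isOpen_preimage.1 (isOpen_preimage_affine i)
  open_target := isOpen_univ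
  continuousOn_toFun := by
    rw [isQuotientMap_mk'.continuousOn_isOpen_iff
      (isQuotientMap_mk'.isOpen_preimage.1 (isOpen_preimage_affine i))]
    refine continuousOn_pi.2 fun a => ?_
    refine ContinuousOn.mul (f := fun v : {v : Fin m → ℂ // v ≠ 0} => (v.1 i)⁻¹)
      (g := fun v => v.1 (skip i a)) ?_
      ((continuous_apply _).comp continuous_subtype_val).continuousOn
    refine ContinuousOn.inv₀
      ((continuous_apply _).comp continuous_subtype_val).continuousOn fun v hv => ?_
    intro h
    exact hv (by simp [h])
  continuousOn_invFun :=
    (isQuotientMap_mk'.continuous.comp ((continuous_insertOne i).subtype_mk (insertOne_ne_zero i))).continuousOn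

lemma exists_mem_affineChart_source (p : ℙ ℂ (Fin m → ℂ)) : ∃ i, p ∈ (affineChart i).source := by
  induction p using Projectivization.ind with
  | h v hv =>
    obtain ⟨i, hi⟩ := Function.ne_iff.1 hv
    exact ⟨i, by simpa [affineChart] using hi⟩

/-- The standard atlas of complex projective space. -/
instance instChartedSpace : ChartedSpace (Fin (m - 1) → ℂ) (ℙ ℂ (Fin m → ℂ)) where
  atlas := Set.range affineChart
  chartAt p := affineChart (exists_mem_affineChart_source p).choose
  mem_chart_source p := (exists_mem_affineChart_source p).choose_spec
  chart_mem_atlas _ := Set.mem_range_self _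

end ProjSpace

/-! ### Holomorphic principal bundles and their automorphisms -/

section PrincipalBundle

variable {EP HP EM HM EG HG : Type*}
  [NormedAddCommGroup EP] [NormedSpace ℂ EP] [TopologicalSpace HP]
  [NormedAddCommGroup EM] [NormedSpace ℂ EM] [TopologicalSpace HM]
  [NormedAddCommGroup EG] [NormedSpace ℂ EG] [TopologicalSpace HG]
  (IP : ModelWithCorners ℂ EP HP) (IM : ModelWithCorners ℂ EM HM) (IG : ModelWithCorners ℂ EG HG)
  {P M : Type*} (G : Type*)
  [TopologicalSpace P] [ChartedSpace HP P] [TopologicalSpace M] [ChartedSpace HM M]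
  [TopologicalSpace G] [ChartedSpace HG G] [CommGroup G] [MulAction G P]

/-- `π : P → M` is a complex (holomorphic) principal fiber bundle with structure group `G`, for the
given action of `G` on `P`. The group is commutative, so left and right actions are the same. -/
structure IsHolomorphicPrincipalBundle (π : P → M) : Prop where
  total_manifold : IsManifold IP ω P
  base_manifold : IsManifold IM ω M
  lieGroup : LieGroup IG ω G
  action_holomorphic : ContMDiff (IG.prod IP) IP ω (fun x : G × P => x.1 • x.2)
  action_free : ∀ (g : G) (u : P), g • u = u → g = 1
  proj_holomorphic : ContMDiff IP IM ω π
  proj_surjective : Function.Surjective π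
  /-- The fibers of `π` are the orbits of `G`. -/
  fiber_eq_orbit : ∀ u v : P, π u = π v ↔ ∃ g : G, g • u = v
  /-- Over some open neighborhood `U` of each point there is a biholomorphism
  `u ↦ (π u, φ u)`, with inverse `ψ`, of `π ⁻¹ U` onto `U × G`, for an equivariant `φ`. -/
  locally_trivial : ∀ x : M, ∃ U : Set M, IsOpen U ∧ x ∈ U ∧ ∃ (φ : P → G) (ψ : M × G → P),
    ContMDiffOn IP IG ω φ (π ⁻¹' U) ∧
    ContMDiffOn (IM.prod IG) IP ω ψ (U ×ˢ Set.univ) ∧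
    (∀ u ∈ π ⁻¹' U, ∀ g : G, φ (g • u) = g * φ u) ∧
    (∀ u ∈ π ⁻¹' U, ψ (π u, φ u) = u) ∧
    (∀ y ∈ U, ∀ g : G, π (ψ (y, g)) = y ∧ φ (ψ (y, g)) = g)

/-- `F` is an automorphism of the principal bundle `π : P → M` with structure group `G` that covers
the transformation `f` of the base: both maps are biholomorphic, `F` commutes with the action of
`G`, and `π ∘ F = f ∘ π`. -/
structure IsPrincipalBundleAutomorphism (π : P → M) (F : P → P) (f : M → M) : Prop where
  biholomorphic : ∃ Φ : P ≃ₘ^ω⟮IP, IP⟯ P, ⇑Φ = F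
  base_biholomorphic : ∃ Φ : M ≃ₘ^ω⟮IM, IM⟯ M, ⇑Φ = f
  equivariant : ∀ (g : G) (u : P), F (g • u) = g • F u
  covers : ∀ u : P, π (F u) = f (π u)

end PrincipalBundle

/-! ### Foliations and Lagrangian frames on submanifolds of a vector space -/

section Foliation

/-- `N` is an embedded complex submanifold of complex dimension `d`: near each of its points it is
the zero set of a holomorphic submersion whose derivative has a kernel of dimension `d`. -/
def IsComplexSubmanifold {E : Type*} [NormedAddCommGroup E] [NormedSpace ℂ E]
    (d : ℕ) (N : Set E) : Prop :=
  ∀ x ∈ N, ∃ (c : ℕ) (f : E → (Fin c → ℂ)), ContDiffAt ℂ ω f x ∧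
    Function.Surjective (fderiv ℂ f x) ∧
    Module.finrank ℂ (LinearMap.ker (fderiv ℂ f x).toLinearMap) = d ∧
    ∀ᶠ y in 𝓝 x, y ∈ N ↔ f y = 0

variable {E : Type*} [NormedAddCommGroup E] [NormedSpace ℝ E]

/-- The tangent space at `x` of a submanifold, or of a leaf of a foliation, `S`: the velocities at
`x` of the smooth curves in `S` through `x`. -/
def tangentSet (S : Set E) (x : E) : Set E :=
  {v | ∃ γ : ℝ → E, ContDiff ℝ ∞ γ ∧ γ 0 = x ∧ (∀ᶠ t in 𝓝 (0 : ℝ), γ t ∈ S) ∧ deriv γ 0 = v}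

/-- The points of `N` that can be reached from `x` by piecewise `C¹` paths in `N` that are tangent
to the distribution `D`. If `D` is integrable, this is the leaf through `x` of its foliation. -/
def accessibleSet (N : Set E) (D : E → Set E) (x : E) : Set E :=
  {y | Relation.ReflTransGen (fun a b => ∃ γ : ℝ → E, ContDiff ℝ 1 γ ∧ γ 0 = a ∧ γ 1 = b ∧
    ∀ t ∈ Set.Icc (0 : ℝ) 1, γ t ∈ N ∧ deriv γ t ∈ D (γ t)) x y}

/-- The tangent distribution of the foliation with leaves `leaf x`. -/
def tangentDist (leaf : E → Set E) (x : E) : Set E :=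
  tangentSet (leaf x) x

/-- The orthogonal complement inside `TN` of the tangent distribution of a foliation of `N`. -/
def normalDist (g : E → E → E → ℝ) (N : Set E) (leaf : E → Set E) (x : E) : Set E :=
  {v ∈ tangentSet N x | ∀ u ∈ tangentDist leaf x, g x u v = 0}

/-- The vector field `X`, defined near `x`, is smooth at `x` and takes its values at the points of
`N` near `x` in the distribution `D`. -/
def IsSectionAt (N : Set E) (D : E → Set E) (X : E → E) (x : E) : Prop :=
  ContDiffAt ℝ ∞ X x ∧ ∀ᶠ y in 𝓝[N] x, X y ∈ D y

/-- The sets `leaf x`, for `x ∈ N`, are the leaves of a smooth foliation of `N` with leaves of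
dimension `d`: their tangent spaces form a smooth involutive distribution of rank `d`, and they are
the maximal connected integral manifolds of that distribution. -/
structure IsSmoothFoliation (N : Set E) (d : ℕ) (leaf : E → Set E) : Prop where
  smooth : ∀ x ∈ N, ∃ X : Fin d → E → E, (∀ i, ContDiffAt ℝ ∞ (X i) x) ∧
    ∀ᶠ y in 𝓝[N] x, LinearIndependent ℝ (fun i => X i y) ∧
      tangentDist leaf y = Submodule.span ℝ (Set.range fun i => X i y)
  involutive : ∀ x ∈ N, ∀ X Y : E → E,
    IsSectionAt N (tangentDist leaf) X x → IsSectionAt N (tangentDist leaf) Y x →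
    VectorField.lieBracket ℝ X Y x ∈ tangentDist leaf x
  leaf_eq : ∀ x ∈ N, leaf x = accessibleSet N (tangentDist leaf) x

/-- The leaves are Lagrangian: each tangent space `T_x L` is its own orthogonal in
`T_x N` with respect to the symplectic form `σ`. -/
def IsLagrangianFoliation (σ : E → E → E → ℝ) (N : Set E) (leaf : E → Set E) : Prop :=
  ∀ x ∈ N, {v ∈ tangentSet N x | ∀ u ∈ tangentDist leaf x, σ x u v = 0} = tangentDist leaf x

/-- The Lie derivative `(L_X g)(Y, Z) = X (g(Y, Z)) - g([X, Y], Z) - g(Y, [X, Z])` at `x`. -/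
def lieDerivMetric (g : E → E → E → ℝ) (X Y Z : E → E) (x : E) : ℝ :=
  fderiv ℝ (fun y => g y (Y y) (Z y)) x (X x)
    - g x (VectorField.lieBracket ℝ X Y x) (Z x) - g x (Y x) (VectorField.lieBracket ℝ X Z x)

/-- The foliation is Riemannian: the metric induced on its normal bundle is invariant under leaf
holonomy, that is, under the flows of the vector fields tangent to the leaves. -/
def IsRiemannianFoliation (g : E → E → E → ℝ) (N : Set E) (leaf : E → Set E) : Prop :=
  ∀ x ∈ N, ∀ X Y Z : E → E, IsSectionAt N (tangentDist leaf) X x →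
    IsSectionAt N (normalDist g N leaf) Y x → IsSectionAt N (normalDist g N leaf) Z x →
    lieDerivMetric g X Y Z x = 0

/-- `g(∇_Y Z, X)` at `x` for the Levi-Civita connection `∇` of `g`, by the Koszul formula. -/
def leviCivita (g : E → E → E → ℝ) (Y Z X : E → E) (x : E) : ℝ :=
  (fderiv ℝ (fun y => g y (Z y) (X y)) x (Y x) + fderiv ℝ (fun y => g y (X y) (Y y)) x (Z x)
    - fderiv ℝ (fun y => g y (Y y) (Z y)) x (X x)
    + g x (VectorField.lieBracket ℝ Y Z x) (X x) - g x (VectorField.lieBracket ℝ Y X x) (Z x)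
    - g x (VectorField.lieBracket ℝ Z X x) (Y x)) / 2

/-- The leaves are totally geodesic in `N`: their second fundamental form vanishes, that is,
`∇_Y Z` has no component normal to the leaves for all `Y`, `Z` tangent to the leaves. -/
def IsTotallyGeodesicFoliation (g : E → E → E → ℝ) (N : Set E) (leaf : E → Set E) : Prop :=
  ∀ x ∈ N, ∀ Y Z X : E → E, IsSectionAt N (tangentDist leaf) Y x →
    IsSectionAt N (tangentDist leaf) Z x → IsSectionAt N (normalDist g N leaf) X x →
    leviCivita g Y Z X x = 0

/-- The pair of foliations with leaves `leafO x` and `leafF x` is a Lagrangian frame of `N`, of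
complex dimension `d`, for the Kähler structure on `N` induced by the Riemannian metric `g` and the
Kähler form `σ` of the ambient space. -/
structure IsLagrangianFrame (g σ : E → E → E → ℝ) (N : Set E) (d : ℕ)
    (leafO leafF : E → Set E) : Prop where
  foliationO : IsSmoothFoliation N d leafO
  foliationF : IsSmoothFoliation N d leafF
  lagrangianO : IsLagrangianFoliation σ N leafO
  lagrangianF : IsLagrangianFoliation σ N leafF
  orthogonal : ∀ x ∈ N, ∀ u ∈ tangentDist leafO x, ∀ v ∈ tangentDist leafF x, g x u v = 0
  riemannianO : IsRiemannianFoliation g N leafO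
  totallyGeodesicF : IsTotallyGeodesicFoliation g N leafF

/-- `f` maps the open set `S` bijectively and smoothly onto itself and preserves the Riemannian
metric `g`. -/
structure IsRiemannianIsometryOn (g : E → E → E → ℝ) (S : Set E) (f : E → E) : Prop where
  bijOn : Set.BijOn f S S
  smooth : ContDiffOn ℝ ∞ f S
  isometric : ∀ z ∈ S, ∀ u v : E, g (f z) (fderiv ℝ f z u) (fderiv ℝ f z v) = g z u v

end Foliation

/-! ### The two Kähler geometries -/

/-- The two cases `𝕌ⁿ = ℂⁿ ⊂ ℙⁿ(ℂ)` and `𝕌ⁿ = 𝔹ⁿ`. -/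
inductive KahlerGeometry
  | projective
  | hyperbolic

namespace KahlerGeometry

variable {ι : Type*} [Fintype ι]

/-- `𝕌ⁿ`: the space `ℂⁿ` in the projective case, its open unit ball in the hyperbolic case. -/
def domain (ι : Type*) [Fintype ι] : KahlerGeometry → Set (EuclideanSpace ℂ ι)
  | projective => Set.univ
  | hyperbolic => Metric.ball 0 1

/-- The sign of the curvature. -/
def sign : KahlerGeometry → ℝ
  | projective => 1
  | hyperbolic => -1

/-- The Hermitian form `∑ h_{kl}(z) u_k conj(v_l)` of the Fubini-Study metric (`ε = 1`), respectively
the complex hyperbolic metric (`ε = -1`), with Kähler form `i ∑ h_{kl} dz_k ∧ d(conj z_l)`, where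
`h_{kl} = ((1 + ε|z|²) δ_{kl} - ε conj(z_k) z_l) / (1 + ε|z|²)²`. -/
def hermitian (X : KahlerGeometry) (z u v : EuclideanSpace ℂ ι) : ℂ :=
  ((1 + X.sign * ‖z‖ ^ 2 : ℝ) * inner ℂ v u - X.sign * (inner ℂ z u * inner ℂ v z)) /
    ((1 + X.sign * ‖z‖ ^ 2 : ℝ) : ℂ) ^ 2

/-- The Riemannian metric `g(u, v) = ω(u, i v)`. -/
def metric (X : KahlerGeometry) (z u v : EuclideanSpace ℂ ι) : ℝ :=
  2 * (X.hermitian z u v).re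

/-- The Kähler form `ω = i ∑ h_{kl} dz_k ∧ d(conj z_l)`. -/
def form (X : KahlerGeometry) (z u v : EuclideanSpace ℂ ι) : ℝ :=
  -2 * (X.hermitian z u v).im

end KahlerGeometry

/-! ### The map `π_k` and the groups that act -/

section Partition

variable {l : ℕ} (k : Fin l → ℕ)

/-- `ℂⁿ` for `n = k_1 + ⋯ + k_l`, with coordinates grouped in blocks: the coordinate `⟨j, a⟩` is the
`a`-th coordinate of `z_(j) ∈ ℂ^{k_j}`. -/
abbrev Cn : Type := EuclideanSpace ℂ (Σ j, Fin (k j))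

/-- The group `(ℂ*)ⁿ`. -/
abbrev CStar : Type := (Σ j, Fin (k j)) → ℂˣ

/-- The base `∏_j ℙ^{k_j - 1}(ℂ)`. -/
abbrev ProjProd : Type := ∀ j, ℙ ℂ (Fin (k j) → ℂ)

/-- The model with corners of the complex manifold `∏_j ℙ^{k_j - 1}(ℂ)`. -/
abbrev projProdModel : ModelWithCorners ℂ (∀ j, Fin (k j - 1) → ℂ)
    (ModelPi fun j => Fin (k j - 1) → ℂ) :=
  ModelWithCorners.pi fun j => 𝓘(ℂ, Fin (k j - 1) → ℂ)

/-- The model with corners of the complex Lie group `(ℂ*)^l`. -/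
abbrev groupModel (l : ℕ) : ModelWithCorners ℂ (Fin l → ℂ) (ModelPi fun _ : Fin l => ℂ) :=
  ModelWithCorners.pi fun _ : Fin l => 𝓘(ℂ, ℂ)

variable {k}

/-- The block `z_(j)` of `z`. -/
def block (z : Cn k) (j : Fin l) : Fin (k j) → ℂ := fun a => z ⟨j, a⟩

/-- The componentwise action of `(ℂ*)ⁿ` on `ℂⁿ`. -/
instance : MulAction (CStar k) (Cn k) where
  smul t z := WithLp.toLp 2 fun i => (t i : ℂ) * z i
  one_smul z := by
    ext i
    exact one_mul (z i)
  mul_smul s t z := by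
    ext i
    exact mul_assoc (s i : ℂ) (t i : ℂ) (z i)

@[simp] lemma cstar_smul_apply (t : CStar k) (z : Cn k) (i : Σ j, Fin (k j)) :
    (t • z) i = (t i : ℂ) * z i := rfl

/-- The componentwise action of an element of `(ℂ*)ⁿ` on the `j`-th block. -/
def blockMap (t : CStar k) (j : Fin l) : (Fin (k j) → ℂ) →ₗ[ℂ] (Fin (k j) → ℂ) where
  toFun v a := (t ⟨j, a⟩ : ℂ) * v a
  map_add' v w := by
    ext a
    exact mul_add _ _ _
  map_smul' c v := by
    ext a
    exact mul_left_comm _ _ _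

lemma blockMap_injective (t : CStar k) (j : Fin l) : Function.Injective (blockMap t j) :=
  fun _ _ h => funext fun a => mul_left_cancel₀ (t ⟨j, a⟩).ne_zero (congrFun h a)

/-- The action of `(ℂ*)ⁿ` on `∏_j ℙ^{k_j - 1}(ℂ)`, the product of the natural actions of
`(ℂ*)^{k_j}` on `ℙ^{k_j - 1}(ℂ)`. -/
instance : MulAction (CStar k) (ProjProd k) where
  smul t p j := (p j).map (blockMap t j) (blockMap_injective t j)
  one_smul p := by
    funext j
    change (p j).map _ _ = p j
    induction p j using Projectivization.ind with
    | h v hv =>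
      rw [Projectivization.map_mk, Projectivization.mk_eq_mk_iff']
      exact ⟨1, by ext a; simp [blockMap]⟩
  mul_smul s t p := by
    funext j
    change (p j).map _ _ = ((p j).map _ _).map _ _
    induction p j using Projectivization.ind with
    | h v hv =>
      rw [Projectivization.map_mk, Projectivization.map_mk, Projectivization.map_mk,
        Projectivization.mk_eq_mk_iff']
      exact ⟨1, by ext a; simp [blockMap, mul_assoc]⟩

variable (k)

/-- `V_k = ∏_j (ℂ^{k_j} \ {0})`, an open subset of `ℂⁿ`. -/
def Vk : TopologicalSpace.Opens (Cn k) where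
  carrier := {z | ∀ j, block z j ≠ 0}
  is_open' := by
    have h : {z : Cn k | ∀ j, block z j ≠ 0} = ⋂ j, {z | block z j ≠ 0} := by
      ext z
      simp
    rw [h]
    refine isOpen_iInter_of_finite fun j => isOpen_ne_fun ?_ continuous_const
    exact continuous_pi fun a => by unfold block; fun_prop

variable {k}

lemma smul_mem_Vk (t : CStar k) {z : Cn k} (hz : z ∈ Vk k) : t • z ∈ Vk k := fun j h =>
  hz j (funext fun a => by simpa [block] using congrFun h a)

/-- The action of `(ℂ*)ⁿ` on `V_k`. -/
instance : MulAction (CStar k) (Vk k) where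
  smul t z := ⟨t • z.1, smul_mem_Vk t z.2⟩
  one_smul z := Subtype.ext (one_smul (CStar k) z.1)
  mul_smul s t z := Subtype.ext (mul_smul s t z.1)

variable (k)

/-- The map `π_k : V_k → ∏_j ℙ^{k_j - 1}(ℂ)`, `z ↦ ([z_(1)], …, [z_(l)])`. -/
def projPi (z : Vk k) : ProjProd k := fun j => Projectivization.mk ℂ (block z.1 j) (z.2 j)

/-- The isomorphism `a ↦ (a_1 1_{[k_1]}, …, a_l 1_{[k_l]})` of `(ℂ*)^l` with
`A_k = ∏_j ℂ* 1_{[k_j]} ⊂ (ℂ*)ⁿ`. -/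
def blockDiag : (Fin l → ℂˣ) →* CStar k where
  toFun a i := a i.1
  map_one' := rfl
  map_mul' _ _ := rfl

/-- The action of `A_k ≅ (ℂ*)^l` on `V_k`: `a · z = (a_1 z_(1), …, a_l z_(l))`. -/
instance : MulAction (Fin l → ℂˣ) (Vk k) := MulAction.compHom (Vk k) (blockDiag k)

/-- The group `A_k = ∏_j ℂ* 1_{[k_j]}` as a subgroup of `(ℂ*)ⁿ`. -/
def Ak : Subgroup (CStar k) := (blockDiag k).range

/-- The compact torus `𝕋ⁿ ⊂ (ℂ*)ⁿ`. -/
def torus : Subgroup (CStar k) where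
  carrier := {t | ∀ i, ‖(t i : ℂ)‖ = 1}
  one_mem' i := by simp
  mul_mem' hs ht i := by simp [hs i, ht i]
  inv_mem' ht i := by simp [ht i]

/-- The torus `T_k = ∏_j 𝕋 1_{[k_j]} = 𝕋ⁿ ∩ A_k`. -/
def Tk : Subgroup (CStar k) := torus k ⊓ Ak k

/-- The group `B_k = ∏_j B_j`, where `B_j = {b ∈ (ℂ*)^{k_j} : b_1 ⋯ b_{k_j} = 1}`. -/
def Bk : Subgroup (CStar k) where
  carrier := {b | ∀ j, ∏ a, b ⟨j, a⟩ = 1}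
  one_mem' j := by simp
  mul_mem' hb hc j := by simp [Finset.prod_mul_distrib, hb j, hc j]
  inv_mem' hb j := by simp [hb j]

variable {k}

/-- `V_k ∩ 𝕌ⁿ`. -/
def VkU (k : Fin l → ℕ) (X : KahlerGeometry) : Set (Cn k) := (Vk k : Set (Cn k)) ∩ X.domain _

/-- The fiber `F_p = π_k⁻¹(p) ∩ V_k ∩ 𝕌ⁿ`. -/
def fiber (X : KahlerGeometry) (p : ProjProd k) : Set (Cn k) :=
  {z | ∃ h : z ∈ Vk k, projPi k ⟨z, h⟩ = p ∧ z ∈ X.domain _}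

/-- The leaf through `z` of the foliation `𝒪_p` of a fiber `F_p` defined by the action of `T_k`. -/
def orbitLeaf (z : Cn k) : Set (Cn k) := {w | ∃ t ∈ Tk k, t • z = w}

/-- The leaf through `z` of the foliation of the fiber `F_p` that integrates the orthogonal
complement of `T𝒪_p` inside `TF_p`. -/
def perpLeaf (X : KahlerGeometry) (p : ProjProd k) (z : Cn k) : Set (Cn k) :=
  accessibleSet (fiber X p) (normalDist X.metric (fiber X p) orbitLeaf) z

end Partition

end

/-! The complexified picture is linear: `π_k` is the quotient of `V_k` by the diagonal group `A_k`,
so a fiber `F_p` is locally open in the complex span of the blocks `z_(1), …, z_(l)` of any of its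
points `z`. For a nonzero complex number `e`, the real span `D_e(z)` of `e z_(1), …, e z_(l)` is
isotropic, because the blocks of `z` are pairwise orthogonal for the Euclidean Hermitian product and
all entries of the Hermitian form of `𝕌ⁿ` between real combinations of the blocks are real. By
dimension it is Lagrangian, with orthogonal complement `i D_e = D_{ie}`. The case `e = i` is tangent
to the orbits of `T_k`, so `e = 1` is tangent to the orthogonal foliation.

The leaves of `D_e` are the orbits of `exp (e ℝ^l)`: a path tangent to `D_e` is recovered by
integrating the logarithmic derivative of its coordinates, and conversely an orbit segment with
endpoints in the ball stays in the ball, since `‖exp (t c) · z‖²` is convex in `t`.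

The torus acts by isometries, so the linear fields spanning `D_i` are Killing and `𝒪_p` is
Riemannian. By the Koszul formula the second fundamental form of the foliation orthogonal to a
Riemannian one vanishes as soon as that foliation is involutive, so `ℱ_p` is totally geodesic. -/

/-! ### Finite products of manifolds -/

section PiManifold

variable {𝕜 : Type*} [NontriviallyNormedField 𝕜] {ι : Type*} [Fintype ι]
  {F : ι → Type*} [∀ i, NormedAddCommGroup (F i)] [∀ i, NormedSpace 𝕜 (F i)]
  {H : ι → Type*} [∀ i, TopologicalSpace (H i)] {I : ∀ i, ModelWithCorners 𝕜 (F i) (H i)}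
  {M : ι → Type*} [∀ i, TopologicalSpace (M i)] [∀ i, ChartedSpace (H i) (M i)]
  {E' H' N : Type*} [NormedAddCommGroup E'] [NormedSpace 𝕜 E'] [TopologicalSpace H']
  {J : ModelWithCorners 𝕜 E' H'} [TopologicalSpace N] [ChartedSpace H' N] {n : WithTop ℕ∞}

theorem contMDiffWithinAt_pi_iff {f : N → ∀ i, M i} {s : Set N} {x : N} :
    ContMDiffWithinAt J (ModelWithCorners.pi I) n f s x ↔
      ∀ i, ContMDiffWithinAt J (I i) n (fun y => f y i) s x := by
  simp only [contMDiffWithinAt_iff, forall_and]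
  exact and_congr continuousWithinAt_pi contDiffWithinAt_pi

theorem contMDiffOn_pi_iff {f : N → ∀ i, M i} {s : Set N} :
    ContMDiffOn J (ModelWithCorners.pi I) n f s ↔
      ∀ i, ContMDiffOn J (I i) n (fun y => f y i) s :=
  ⟨fun h i x hx => contMDiffWithinAt_pi_iff.1 (h x hx) i,
    fun h x hx => contMDiffWithinAt_pi_iff.2 fun i => h i x hx⟩

theorem contMDiff_pi_iff {f : N → ∀ i, M i} :
    ContMDiff J (ModelWithCorners.pi I) n f ↔ ∀ i, ContMDiff J (I i) n (fun y => f y i) := by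
  simp only [← contMDiffOn_univ, contMDiffOn_pi_iff]

theorem contMDiff_eval (i : ι) :
    ContMDiff (ModelWithCorners.pi I) (I i) n (fun x : ∀ i, M i => x i) :=
  contMDiff_pi_iff.1 contMDiff_id i

theorem isManifold_pi [∀ i, IsManifold (I i) n (M i)] :
    IsManifold (ModelWithCorners.pi I) n (∀ i, M i) := by
  refine isManifold_of_contDiffOn _ _ _ ?_
  rintro _ _ ⟨e, he, rfl⟩ ⟨e', he', rfl⟩
  refine contDiffOn_pi.2 fun i => ?_
  have transition_i : ContDiffOn 𝕜 n (I i ∘ (e i).symm ≫ₕ e' i ∘ (I i).symm)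
      ((I i).symm ⁻¹' ((e i).symm ≫ₕ e' i).source ∩ Set.range (I i)) :=
    ((contDiffGroupoid n (I i)).compatible (he i trivial) (he' i trivial)).1
  refine transition_i.comp (ContinuousLinearMap.proj (R := 𝕜) (φ := F) i).contDiff.contDiffOn ?_
  rintro x ⟨⟨hx₁, hx₂⟩, y, rfl⟩
  exact ⟨⟨hx₁ i trivial, hx₂ i trivial⟩, y i, rfl⟩

theorem lieGroup_pi {G : ι → Type*} [∀ i, TopologicalSpace (G i)] [∀ i, ChartedSpace (H i) (G i)]
    [∀ i, Group (G i)] [∀ i, LieGroup (I i) n (G i)] :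
    LieGroup (ModelWithCorners.pi I) n (∀ i, G i) where
  toIsManifold := isManifold_pi
  contMDiff_mul := contMDiff_pi_iff.2 fun i =>
    ((contMDiff_eval i).comp contMDiff_fst).mul ((contMDiff_eval i).comp contMDiff_snd)
  contMDiff_inv := contMDiff_pi_iff.2 fun i => (contMDiff_eval i).inv

end PiManifold

section Maps

variable {𝕜 : Type*} [NontriviallyNormedField 𝕜]
  {E' H' N : Type*} [NormedAddCommGroup E'] [NormedSpace 𝕜 E'] [TopologicalSpace H']
  {J : ModelWithCorners 𝕜 E' H'} [TopologicalSpace N] [ChartedSpace H' N] {n : WithTop ℕ∞}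
  {s : Set N} {x : N}

theorem contMDiffWithinAt_opens_iff {F : Type*} [NormedAddCommGroup F] [NormedSpace 𝕜 F]
    {U : TopologicalSpace.Opens F} {f : N → U} :
    ContMDiffWithinAt J 𝓘(𝕜, F) n f s x ↔
      ContMDiffWithinAt J 𝓘(𝕜, F) n (fun y => (f y : F)) s x :=
  (ChartedSpace.liftPropWithinAt_subtypeVal_comp_iff ..).symm

theorem contMDiffWithinAt_units_iff {R : Type*} [NormedRing R] [CompleteSpace R]
    [NormedAlgebra 𝕜 R] {f : N → Rˣ} :
    ContMDiffWithinAt J 𝓘(𝕜, R) n f s x ↔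
      ContMDiffWithinAt J 𝓘(𝕜, R) n (fun y => (f y : R)) s x := by
  rw [contMDiffWithinAt_iff_target]
  exact ⟨And.right, fun h =>
    ⟨Units.isOpenEmbedding_val.isInducing.continuousWithinAt_iff.2 h.continuousWithinAt, h⟩⟩

theorem contMDiffWithinAt_piLp_iff {ι : Type*} [Fintype ι] {F : ι → Type*}
    [∀ i, NormedAddCommGroup (F i)] [∀ i, NormedSpace 𝕜 (F i)] {p : ENNReal} [Fact (1 ≤ p)]
    {f : N → PiLp p F} :
    ContMDiffWithinAt J 𝓘(𝕜, PiLp p F) n f s x ↔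
      ∀ i, ContMDiffWithinAt J 𝓘(𝕜, F i) n (fun y => f y i) s x := by
  rw [← contMDiffWithinAt_pi_space]
  let e := PiLp.continuousLinearEquiv p 𝕜 F
  exact ⟨e.contDiff.contMDiff.contMDiffAt.comp_contMDiffWithinAt x,
    e.symm.contDiff.contMDiff.contMDiffAt.comp_contMDiffWithinAt (f := e ∘ f) x⟩

end Maps

/-! ### Projective space -/

namespace ProjSpace

variable {m : ℕ}

theorem normalized_mk_self_ne_zero_iff (i : Fin m) {v : Fin m → ℂ} (hv : v ≠ 0) :
    normalized i (Projectivization.mk ℂ v hv) i ≠ 0 ↔ v i ≠ 0 := by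
  simp

theorem contDiff_insertOne {n : WithTop ℕ∞} (i : Fin m) : ContDiff ℂ n (insertOne i) := by
  refine contDiff_pi.2 fun c => ?_
  unfold insertOne
  split_ifs <;> fun_prop

instance isManifold : IsManifold 𝓘(ℂ, Fin (m - 1) → ℂ) ω (ℙ ℂ (Fin m → ℂ)) := by
  refine isManifold_of_contDiffOn _ _ _ ?_
  rintro _ _ ⟨i, rfl⟩ ⟨j, rfl⟩
  refine contDiffOn_pi.2 fun a => ?_
  have coord_contDiff (c : Fin m) : ContDiff ℂ ω fun w => insertOne i w c :=
    contDiff_pi.1 (contDiff_insertOne i) c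
  have transition : ContDiffOn ℂ ω (fun w => (insertOne i w j)⁻¹ * insertOne i w (skip j a))
      {w | insertOne i w j ≠ 0} :=
    ((coord_contDiff j).contDiffOn.inv fun w hw => hw).mul (coord_contDiff _).contDiffOn
  exact transition.mono fun w hw =>
    (normalized_mk_self_ne_zero_iff j (insertOne_ne_zero i w)).1 hw.1.2

theorem normalized_self {i : Fin m} {p : ℙ ℂ (Fin m → ℂ)} (hp : normalized i p i ≠ 0) :
    normalized i p i = 1 := by
  induction p using Projectivization.ind with
  | h v hv => simp [(normalized_mk_self_ne_zero_iff i hv).1 hp]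

theorem mk_normalized {i : Fin m} {p : ℙ ℂ (Fin m → ℂ)} (h : normalized i p ≠ 0) :
    Projectivization.mk ℂ (normalized i p) h = p := by
  induction p using Projectivization.ind with
  | h v hv => exact (Projectivization.mk_eq_mk_iff' ..).2 ⟨(v i)⁻¹, rfl⟩

variable {E' H' N : Type*} [NormedAddCommGroup E'] [NormedSpace ℂ E'] [TopologicalSpace H']
  {J : ModelWithCorners ℂ E' H'} [TopologicalSpace N] [ChartedSpace H' N]

theorem contMDiffOn_of_eq_mk {f : N → ℙ ℂ (Fin m → ℂ)} {v : N → Fin m → ℂ} {s : Set N}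
    (hv : ContMDiffOn J 𝓘(ℂ, Fin m → ℂ) ω v s)
    (hf : ∀ y ∈ s, ∃ h : v y ≠ 0, f y = Projectivization.mk ℂ (v y) h) :
    ContMDiffOn J 𝓘(ℂ, Fin (m - 1) → ℂ) ω f s := by
  intro x hx
  obtain ⟨hvx, -⟩ := hf x hx
  obtain ⟨i, hi⟩ := Function.ne_iff.1 hvx
  have chart_symm : ContMDiff 𝓘(ℂ, Fin (m - 1) → ℂ) 𝓘(ℂ, Fin (m - 1) → ℂ) ω
      (affineChart i).symm :=
    contMDiffOn_univ.1 (contMDiffOn_symm_of_mem_maximalAtlas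
      (IsManifold.subset_maximalAtlas (Set.mem_range_self i)))
  have quotients : ContDiffAt ℂ ω (fun u : Fin m → ℂ => fun a => (u i)⁻¹ * u (skip i a)) (v x) :=
    contDiffAt_pi.2 fun a =>
      ((contDiff_apply ℂ ℂ i).contDiffAt.inv hi).mul (contDiff_apply ℂ ℂ _).contDiffAt
  have eq_chart : ∀ y ∈ s, v y i ≠ 0 →
      f y = (affineChart i).symm fun a => (v y i)⁻¹ * v y (skip i a) := by
    intro y hy hyi
    obtain ⟨hvy, hfy⟩ := hf y hy
    rw [hfy]
    exact ((affineChart i).left_inv ((normalized_mk_self_ne_zero_iff i hvy).2 hyi)).symm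
  have near_x : ∀ᶠ y in 𝓝[s] x, v y i ≠ 0 :=
    ((continuous_apply i).continuousAt.comp_continuousWithinAt
      (hv x hx).continuousWithinAt).eventually_ne hi
  refine (chart_symm.contMDiffAt.comp_contMDiffWithinAt x
    (quotients.contMDiffAt.comp_contMDiffWithinAt x (hv x hx))).congr_of_eventuallyEq ?_
    (eq_chart x hx hi)
  filter_upwards [near_x, self_mem_nhdsWithin] with y hyi hy using eq_chart y hy hyi

theorem contMDiffOn_normalized (i : Fin m) :
    ContMDiffOn 𝓘(ℂ, Fin (m - 1) → ℂ) 𝓘(ℂ, Fin m → ℂ) ω (normalized i)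
      {p | normalized i p i ≠ 0} := by
  have chart : ContMDiffOn 𝓘(ℂ, Fin (m - 1) → ℂ) 𝓘(ℂ, Fin (m - 1) → ℂ) ω (affineChart i)
      (affineChart i).source :=
    contMDiffOn_of_mem_maximalAtlas (IsManifold.subset_maximalAtlas (Set.mem_range_self i))
  exact ((contDiff_insertOne i).contMDiff.comp_contMDiffOn chart).congr fun p hp =>
    (insertOne_comp_skip i _ (normalized_self hp)).symm

theorem contMDiff_map {n : ℕ} (f : (Fin m → ℂ) →ₗ[ℂ] (Fin n → ℂ)) (hf : Function.Injective f) :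
    ContMDiff 𝓘(ℂ, Fin (m - 1) → ℂ) 𝓘(ℂ, Fin (n - 1) → ℂ) ω (Projectivization.map f hf) := by
  intro p
  obtain ⟨i, hi⟩ := exists_mem_affineChart_source p
  have f_contDiff : ContDiff ℂ ω f := (LinearMap.toContinuousLinearMap f).contDiff
  refine (contMDiffOn_of_eq_mk (f_contDiff.contMDiff.comp_contMDiffOn (contMDiffOn_normalized i))
    fun y hy => ?_).contMDiffAt ((affineChart i).open_source.mem_nhds hi)
  have h0 : normalized i y ≠ 0 := fun h => hy (congrFun h i)
  refine ⟨(map_ne_zero_iff f hf).2 h0, ?_⟩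
  conv_lhs => rw [← mk_normalized h0, Projectivization.map_mk]
  rfl

end ProjSpace

/-! ### The principal bundle `π_k` -/

section PrincipalBundle

variable {EP HP EM HM EG HG : Type*}
  [NormedAddCommGroup EP] [NormedSpace ℂ EP] [TopologicalSpace HP]
  [NormedAddCommGroup EM] [NormedSpace ℂ EM] [TopologicalSpace HM]
  [NormedAddCommGroup EG] [NormedSpace ℂ EG] [TopologicalSpace HG]
  {IP : ModelWithCorners ℂ EP HP} {IM : ModelWithCorners ℂ EM HM} {IG : ModelWithCorners ℂ EG HG}
  {P M G : Type*}
  [TopologicalSpace P] [ChartedSpace HP P] [TopologicalSpace M] [ChartedSpace HM M]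
  [TopologicalSpace G] [ChartedSpace HG G] [Group G] [MulAction G P]

theorem exists_trivialization_of_section {π : P → M} {U : Set M} {σ : M → P} {φ : P → G}
    (action_holomorphic : ContMDiff (IG.prod IP) IP ω (fun x : G × P => x.1 • x.2))
    (action_free : ∀ (g : G) (u : P), g • u = u → g = 1)
    (proj_smul : ∀ (g : G) (u : P), π (g • u) = π u)
    (hσ : ContMDiffOn IM IP ω σ U) (proj_section : ∀ y ∈ U, π (σ y) = y)
    (hφ : ContMDiffOn IP IG ω φ (π ⁻¹' U)) (smul_section : ∀ u ∈ π ⁻¹' U, φ u • σ (π u) = u) :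
    ∃ (φ : P → G) (ψ : M × G → P),
      ContMDiffOn IP IG ω φ (π ⁻¹' U) ∧
      ContMDiffOn (IM.prod IG) IP ω ψ (U ×ˢ Set.univ) ∧
      (∀ u ∈ π ⁻¹' U, ∀ g : G, φ (g • u) = g * φ u) ∧
      (∀ u ∈ π ⁻¹' U, ψ (π u, φ u) = u) ∧
      (∀ y ∈ U, ∀ g : G, π (ψ (y, g)) = y ∧ φ (ψ (y, g)) = g) := by
  have smul_left_injective (u : P) {g h : G} (e : g • u = h • u) : g = h :=
    (inv_mul_eq_one.1 (action_free _ u (by rw [mul_smul, e, inv_smul_smul]))).symm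
  refine ⟨φ, fun q => q.2 • σ q.1, hφ, ?_, fun u hu g => ?_, smul_section, fun y hy g => ?_⟩
  · exact action_holomorphic.comp_contMDiffOn
      (contMDiff_snd.contMDiffOn.prodMk (hσ.comp contMDiff_fst.contMDiffOn fun q hq => hq.1))
  · have hgu : g • u ∈ π ⁻¹' U := by rwa [Set.mem_preimage, proj_smul]
    have h := smul_section _ hgu
    rw [proj_smul] at h
    exact smul_left_injective (σ (π u)) (by rw [h, mul_smul, smul_section u hu])
  · have hπ : π (g • σ y) = y := by rw [proj_smul, proj_section y hy]
    have h := smul_section (g • σ y) (by rwa [Set.mem_preimage, hπ])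
    rw [hπ] at h
    exact ⟨hπ, smul_left_injective (σ y) h⟩

end PrincipalBundle

section Bundle

variable {l : ℕ} {k : Fin l → ℕ}

theorem contMDiff_coord (i : Σ j, Fin (k j)) :
    ContMDiff 𝓘(ℂ, Cn k) 𝓘(ℂ, ℂ) ω (fun z : Vk k => z.1 i) := by
  have coord_contDiff : ContDiff ℂ ω (fun z : Cn k => z i) := by fun_prop
  exact coord_contDiff.contMDiff.comp contMDiff_subtype_val

theorem contMDiffOn_Vk_iff {E' H' N : Type*} [NormedAddCommGroup E'] [NormedSpace ℂ E']
    [TopologicalSpace H'] {J : ModelWithCorners ℂ E' H'} [TopologicalSpace N] [ChartedSpace H' N]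
    {f : N → Vk k} {s : Set N} :
    ContMDiffOn J 𝓘(ℂ, Cn k) ω f s ↔ ∀ i, ContMDiffOn J 𝓘(ℂ, ℂ) ω (fun y => (f y).1 i) s := by
  simp only [ContMDiffOn, contMDiffWithinAt_opens_iff, contMDiffWithinAt_piLp_iff]
  exact ⟨fun h i x hx => h x hx i, fun h x hx i => h i x hx⟩

theorem contMDiff_projPi : ContMDiff 𝓘(ℂ, Cn k) (projProdModel k) ω (projPi k) :=
  contMDiff_pi_iff.2 fun j => contMDiffOn_univ.1 <|
    ProjSpace.contMDiffOn_of_eq_mk (v := fun z : Vk k => block z.1 j)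
      (contMDiffOn_pi_space.2 fun a => (contMDiff_coord ⟨j, a⟩).contMDiffOn)
      fun z _ => ⟨z.2 j, rfl⟩

theorem contMDiff_smul_Vk (b : CStar k) :
    ContMDiff 𝓘(ℂ, Cn k) 𝓘(ℂ, Cn k) ω (fun z : Vk k => b • z) :=
  contMDiffOn_univ.1 <| contMDiffOn_Vk_iff.2 fun i =>
    (contMDiff_const.mul (contMDiff_coord i)).contMDiffOn

theorem contMDiff_smul_projProd (b : CStar k) :
    ContMDiff (projProdModel k) (projProdModel k) ω (fun p : ProjProd k => b • p) :=
  contMDiff_pi_iff.2 fun j =>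
    (ProjSpace.contMDiff_map (blockMap b j) (blockMap_injective b j)).comp (contMDiff_eval j)

theorem isPrincipalBundleAutomorphism_smul (b : CStar k) :
    IsPrincipalBundleAutomorphism 𝓘(ℂ, Cn k) (projProdModel k) (Fin l → ℂˣ)
      (projPi k) (fun z => b • z) (fun p => b • p) where
  biholomorphic := ⟨⟨MulAction.toPerm b, contMDiff_smul_Vk b, contMDiff_smul_Vk b⁻¹⟩, rfl⟩
  base_biholomorphic :=
    ⟨⟨MulAction.toPerm b, contMDiff_smul_projProd b, contMDiff_smul_projProd b⁻¹⟩, rfl⟩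
  equivariant g u := by
    change b • (blockDiag k g • u) = blockDiag k g • (b • u)
    rw [smul_smul, smul_smul, mul_comm]
  covers _ := rfl

theorem blockDiag_smul_apply (g : Fin l → ℂˣ) (u : Vk k) (i : Σ j, Fin (k j)) :
    (g • u).1 i = (g i.1 : ℂ) * u.1 i := rfl

theorem contMDiff_blockDiag_smul :
    ContMDiff ((groupModel l).prod 𝓘(ℂ, Cn k)) 𝓘(ℂ, Cn k) ω
      (fun x : (Fin l → ℂˣ) × Vk k => x.1 • x.2) :=
  contMDiffOn_univ.1 <| contMDiffOn_Vk_iff.2 fun i =>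
    (((Units.contMDiff_val (𝕜 := ℂ) (R := ℂ)).comp ((contMDiff_eval i.1).comp contMDiff_fst)).mul
      ((contMDiff_coord i).comp contMDiff_snd)).contMDiffOn

theorem eq_one_of_blockDiag_smul_eq_self (g : Fin l → ℂˣ) (u : Vk k) (h : g • u = u) : g = 1 := by
  funext j
  obtain ⟨a, ha⟩ := Function.ne_iff.1 (u.2 j)
  have coord_eq : (g j : ℂ) * u.1 ⟨j, a⟩ = u.1 ⟨j, a⟩ := by
    rw [← blockDiag_smul_apply g u ⟨j, a⟩, h]
  ext
  exact mul_right_cancel₀ ha (coord_eq.trans (one_mul _).symm)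

theorem projPi_blockDiag_smul (g : Fin l → ℂˣ) (u : Vk k) : projPi k (g • u) = projPi k u :=
  funext fun j => (Projectivization.mk_eq_mk_iff ℂ _ _ _ _).2 ⟨g j, rfl⟩

theorem projPi_eq_iff (u v : Vk k) : projPi k u = projPi k v ↔ ∃ g : Fin l → ℂˣ, g • u = v := by
  refine ⟨fun h => ?_, fun ⟨g, hg⟩ => hg ▸ (projPi_blockDiag_smul g u).symm⟩
  choose g hg using fun j => (Projectivization.mk_eq_mk_iff ℂ _ _ _ _).1 (congrFun h j).symm
  refine ⟨g, Subtype.ext ?_⟩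
  ext i
  exact congrFun (hg i.1) i.2

theorem projPi_surjective : Function.Surjective (projPi k) := fun p =>
  ⟨⟨WithLp.toLp 2 fun i => (p i.1).rep i.2, fun j => (p j).rep_nonzero⟩,
    funext fun j => (p j).mk_rep⟩

/-- The open set of `∏_j ℙ^{k_j - 1}(ℂ)` on which the `c j`-th homogeneous coordinate of the `j`-th
factor does not vanish; the bundle `π_k` has a section over it. -/
def affineSet (c : ∀ j, Fin (k j)) : Set (ProjProd k) :=
  {p | ∀ j, ProjSpace.normalized (c j) (p j) (c j) ≠ 0}

theorem isOpen_affineSet (c : ∀ j, Fin (k j)) : IsOpen (affineSet c) := by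
  have inter : affineSet c = ⋂ j, (fun p => p j) ⁻¹' (ProjSpace.affineChart (c j)).source := by
    ext p
    simp [affineSet, ProjSpace.affineChart]
  rw [inter]
  exact isOpen_iInter_of_finite fun j =>
    (ProjSpace.affineChart (c j)).open_source.preimage (continuous_apply j)

theorem exists_normalized_section (c : ∀ j, Fin (k j)) :
    ∃ σ : ProjProd k → Vk k, ∀ p ∈ affineSet c, projPi k (σ p) = p ∧
      ∀ i, (σ p).1 i = ProjSpace.normalized (c i.1) (p i.1) i.2 := by
  have exists_lift (p : ProjProd k) : ∃ u : Vk k, p ∈ affineSet c → projPi k u = p ∧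
      ∀ i, u.1 i = ProjSpace.normalized (c i.1) (p i.1) i.2 := by
    by_cases hp : p ∈ affineSet c
    · have h0 (j) : ProjSpace.normalized (c j) (p j) ≠ 0 := fun h => hp j (congrFun h (c j))
      exact ⟨⟨WithLp.toLp 2 fun i => ProjSpace.normalized (c i.1) (p i.1) i.2, h0⟩,
        fun _ => ⟨funext fun j => ProjSpace.mk_normalized (h0 j), fun _ => rfl⟩⟩
    · exact ⟨(projPi_surjective p).choose, fun h => (hp h).elim⟩
  choose σ hσ using exists_lift
  exact ⟨σ, hσ⟩

theorem exists_trivialization_projPi (c : ∀ j, Fin (k j)) :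
    ∃ (φ : Vk k → (Fin l → ℂˣ)) (ψ : ProjProd k × (Fin l → ℂˣ) → Vk k),
      ContMDiffOn 𝓘(ℂ, Cn k) (groupModel l) ω φ (projPi k ⁻¹' affineSet c) ∧
      ContMDiffOn ((projProdModel k).prod (groupModel l)) 𝓘(ℂ, Cn k) ω ψ
        (affineSet c ×ˢ Set.univ) ∧
      (∀ u ∈ projPi k ⁻¹' affineSet c, ∀ g : Fin l → ℂˣ, φ (g • u) = g * φ u) ∧
      (∀ u ∈ projPi k ⁻¹' affineSet c, ψ (projPi k u, φ u) = u) ∧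
      (∀ y ∈ affineSet c, ∀ g : Fin l → ℂˣ, projPi k (ψ (y, g)) = y ∧ φ (ψ (y, g)) = g) := by
  obtain ⟨σ, hσ⟩ := exists_normalized_section c
  have exists_smul (u : Vk k) : ∃ g : Fin l → ℂˣ,
      u ∈ projPi k ⁻¹' affineSet c → g • σ (projPi k u) = u := by
    by_cases hu : u ∈ projPi k ⁻¹' affineSet c
    · obtain ⟨g, hg⟩ := (projPi_eq_iff _ _).1 (hσ _ hu).1
      exact ⟨g, fun _ => hg⟩
    · exact ⟨1, fun h => (hu h).elim⟩
  choose φ hφ using exists_smul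
  have φ_eq_coord : ∀ u ∈ projPi k ⁻¹' affineSet c, ∀ j, (φ u j : ℂ) = u.1 ⟨j, c j⟩ := by
    intro u hu j
    conv_rhs => rw [← hφ u hu, blockDiag_smul_apply, (hσ _ hu).2,
      ProjSpace.normalized_self (hu j), mul_one]
  refine exists_trivialization_of_section contMDiff_blockDiag_smul eq_one_of_blockDiag_smul_eq_self
    projPi_blockDiag_smul (σ := σ) ?_ (fun p hp => (hσ p hp).1) (φ := φ) ?_ hφ
  · refine contMDiffOn_Vk_iff.2 fun i => ?_
    have normalized_contMDiffOn : ContMDiffOn (projProdModel k) 𝓘(ℂ, Fin (k i.1) → ℂ) ω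
        (fun p : ProjProd k => ProjSpace.normalized (c i.1) (p i.1)) (affineSet c) :=
      (ProjSpace.contMDiffOn_normalized (c i.1)).comp (contMDiff_eval i.1).contMDiffOn
        fun p hp => hp i.1
    exact (contMDiffOn_pi_space.1 normalized_contMDiffOn i.2).congr fun p hp => (hσ p hp).2 i
  · exact contMDiffOn_pi_iff.2 fun j u hu => contMDiffWithinAt_units_iff.2 <|
      (contMDiff_coord ⟨j, c j⟩).contMDiffAt.contMDiffWithinAt.congr_of_mem
        (fun v hv => φ_eq_coord v hv j) hu

theorem isHolomorphicPrincipalBundle_projPi :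
    IsHolomorphicPrincipalBundle 𝓘(ℂ, Cn k) (projProdModel k) (groupModel l) (Fin l → ℂˣ)
      (projPi k) where
  total_manifold := inferInstance
  base_manifold := isManifold_pi
  lieGroup := lieGroup_pi
  action_holomorphic := contMDiff_blockDiag_smul
  action_free := eq_one_of_blockDiag_smul_eq_self
  proj_holomorphic := contMDiff_projPi
  proj_surjective := projPi_surjective
  fiber_eq_orbit := projPi_eq_iff
  locally_trivial x := by
    choose c hc using fun j => ProjSpace.exists_mem_affineChart_source (x j)
    exact ⟨affineSet c, isOpen_affineSet c, hc, exists_trivialization_projPi c⟩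

end Bundle

/-! ### Tangent sets and submanifolds -/

section Submanifold

theorem isComplexSubmanifold_of_eventually_mem_iff {E : Type*} [NormedAddCommGroup E]
    [NormedSpace ℂ E] [FiniteDimensional ℂ E] {d : ℕ} {N : Set E}
    (h : ∀ x ∈ N, ∃ S : Submodule ℂ E, Module.finrank ℂ S = d ∧ ∀ᶠ y in 𝓝 x, y ∈ N ↔ y ∈ S) :
    IsComplexSubmanifold d N := by
  intro x hx
  obtain ⟨S, hd, hS⟩ := h x hx
  let e := (Module.finBasis ℂ (E ⧸ S)).equivFun
  let q : E →L[ℂ] (Fin (Module.finrank ℂ (E ⧸ S)) → ℂ) :=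
    LinearMap.toContinuousLinearMap (e.toLinearMap ∘ₗ S.mkQ)
  have ker_q : LinearMap.ker q.toLinearMap = S := by
    change LinearMap.ker (e.toLinearMap ∘ₗ S.mkQ) = S
    rw [LinearEquiv.ker_comp, Submodule.ker_mkQ]
  refine ⟨_, q, q.contDiff.contDiffAt, ?_, ?_, ?_⟩
  · rw [q.fderiv]
    exact e.surjective.comp S.mkQ_surjective
  · rw [q.fderiv, ker_q, hd]
  · filter_upwards [hS] with y hy
    rw [hy, ← SetLike.ext_iff.1 ker_q y]
    rfl

variable {E : Type*} [NormedAddCommGroup E] [NormedSpace ℝ E]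
  {F : Type*} [NormedAddCommGroup F] [NormedSpace ℝ F] {N : Set E} {x v : E}

theorem fderiv_apply_eq_of_mem_tangentSet {f g : E → F} (hf : DifferentiableAt ℝ f x)
    (hg : DifferentiableAt ℝ g x) (hfg : f =ᶠ[𝓝[N] x] g) (hv : v ∈ tangentSet N x) :
    fderiv ℝ f x v = fderiv ℝ g x v := by
  obtain ⟨γ, hγ, rfl, hN, rfl⟩ := hv
  have hγ' : HasDerivAt γ (deriv γ 0) 0 := (hγ.differentiable (by simp) 0).hasDerivAt
  refine (hf.hasFDerivAt.comp_hasDerivAt 0 hγ').unique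
    ((hg.hasFDerivAt.comp_hasDerivAt 0 hγ').congr_of_eventuallyEq ?_)
  exact (tendsto_nhdsWithin_iff.2 ⟨hγ.continuous.continuousAt, hN⟩).eventually hfg

theorem tangentSet_subset_submodule {S : Submodule ℝ E} (hS : IsClosed (S : Set E))
    (h : ∀ᶠ y in 𝓝[N] x, y ∈ S) : tangentSet N x ⊆ S := by
  rintro _ ⟨γ, hγ, rfl, hN, rfl⟩
  have hγS : ∀ᶠ t in 𝓝 0, γ t ∈ S :=
    (tendsto_nhdsWithin_iff.2 ⟨hγ.continuous.continuousAt, hN⟩).eventually h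
  have hslope := (hγ.differentiable (by simp) 0).hasDerivAt.tendsto_slope
  refine hS.mem_of_tendsto hslope ((hγS.filter_mono nhdsWithin_le_nhds).mono fun t ht => ?_)
  exact S.smul_mem _ (S.sub_mem ht hγS.self_of_nhds)

theorem tangentSet_eq_submodule {S : Submodule ℝ E} (hS : IsClosed (S : Set E)) (hx : x ∈ S)
    (h : ∀ᶠ y in 𝓝 x, y ∈ N ↔ y ∈ S) : tangentSet N x = S := by
  refine (tangentSet_subset_submodule hS (eventually_nhdsWithin_iff.2
    (h.mono fun y hy => hy.1))).antisymm fun v hv => ?_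
  have hγ : ContDiff ℝ ∞ fun t : ℝ => x + t • v := by fun_prop
  have hγ0 : Filter.Tendsto (fun t : ℝ => x + t • v) (𝓝 0) (𝓝 x) := by
    simpa using hγ.continuous.tendsto 0
  refine ⟨_, hγ, by simp, ?_, ?_⟩
  · filter_upwards [hγ0.eventually h] with t ht
    exact ht.2 (S.add_mem hx (S.smul_mem t hv))
  · simpa using (((hasDerivAt_id (0 : ℝ)).smul_const v).const_add x).deriv

theorem accessibleSet_congr {D D' : E → Set E} (h : ∀ y ∈ N, D y = D' y) :
    accessibleSet N D = accessibleSet N D' := by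
  funext x
  have step_iff (a b : E) : (∃ γ : ℝ → E, ContDiff ℝ 1 γ ∧ γ 0 = a ∧ γ 1 = b ∧
      ∀ t ∈ Set.Icc (0 : ℝ) 1, γ t ∈ N ∧ deriv γ t ∈ D (γ t)) ↔
      ∃ γ : ℝ → E, ContDiff ℝ 1 γ ∧ γ 0 = a ∧ γ 1 = b ∧
      ∀ t ∈ Set.Icc (0 : ℝ) 1, γ t ∈ N ∧ deriv γ t ∈ D' (γ t) := by
    refine exists_congr fun γ => and_congr_right fun _ => and_congr_right fun _ =>
      and_congr_right fun _ => forall₂_congr fun t _ => and_congr_right fun hN => ?_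
    rw [h _ hN]
  simp only [accessibleSet, step_iff]

theorem isSectionAt_congr {D D' : E → Set E} (h : ∀ y ∈ N, D y = D' y) {V : E → E} :
    IsSectionAt N D V x ↔ IsSectionAt N D' V x := by
  refine and_congr_right fun _ => Filter.eventually_congr ?_
  filter_upwards [self_mem_nhdsWithin] with y hy
  rw [h y hy]

end Submanifold

/-! ### Foliations by the orbits of a commutative linear action -/

section LinearAction

variable {E F : Type*} [NormedAddCommGroup E] [NormedSpace ℝ E]
  [NormedAddCommGroup F] [NormedSpace ℝ F]
  {A : F →L[ℝ] E →L[ℝ] E} {N : Set E} {leaf : E → Set E} {x u : E} {V W : E → E} {s r : E → F}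

/-- The distribution spanned by the linear vector fields `y ↦ A c y`, that is, the tangent
distribution of the orbits of an infinitesimal linear action `A` of the vector space `F` on `E`. -/
noncomputable def actionDist (A : F →L[ℝ] E →L[ℝ] E) (x : E) : Submodule ℝ E :=
  LinearMap.range (A.flip x).toLinearMap

theorem hasLeftInverse_of_injective [FiniteDimensional ℝ F] {f : F →L[ℝ] E}
    (hf : Function.Injective f) : f.HasLeftInverse := by
  obtain ⟨proj, hproj⟩ :=
    Submodule.ClosedComplemented.of_finiteDimensional (𝕜 := ℝ) (LinearMap.range f.toLinearMap)
  let e : F ≃ₗ[ℝ] LinearMap.range f.toLinearMap := LinearEquiv.ofInjective f.toLinearMap hf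
  refine ⟨(LinearMap.toContinuousLinearMap e.symm.toLinearMap).comp proj, fun c => ?_⟩
  have proj_apply : proj (f c) = e c := hproj (e c)
  simp [proj_apply]

theorem exists_differentiableAt_coeff [FiniteDimensional ℝ F]
    (hA : Function.Injective (A.flip x)) (hV : DifferentiableAt ℝ V x)
    (hVA : ∀ᶠ y in 𝓝[N] x, V y ∈ actionDist A y) :
    ∃ s : E → F, DifferentiableAt ℝ s x ∧ V =ᶠ[𝓝[N] x] fun y => A (s y) y := by
  have : CompleteSpace F := FiniteDimensional.complete ℝ F
  obtain ⟨Λ, hΛ⟩ := hasLeftInverse_of_injective hA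
  let L : E →L[ℝ] F →L[ℝ] F := (ContinuousLinearMap.compL ℝ F E F Λ).comp A.flip
  have hLx : L x = 1 := ContinuousLinearMap.ext hΛ
  have isUnit_L : IsUnit (L x) := hLx ▸ isUnit_one
  refine ⟨fun y => Ring.inverse (L y) (Λ (V y)), ?_, ?_⟩
  · exact ((differentiableAt_inverse isUnit_L).comp x L.differentiableAt).clm_apply
      (Λ.differentiableAt.comp x hV)
  · filter_upwards [hVA, nhdsWithin_le_nhds (L.continuous.continuousAt.eventually
      (Units.isOpen.mem_nhds isUnit_L))] with y ⟨c, hc⟩ hy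
    have inverse_apply : Ring.inverse (L y) (L y c) = c :=
      DFunLike.congr_fun (Ring.inverse_mul_cancel _ hy) c
    have hLc : L y c = Λ (V y) := congrArg Λ hc
    rw [← hLc, inverse_apply]
    exact hc.symm

theorem fderiv_section_apply (hV : DifferentiableAt ℝ V x) (hs : DifferentiableAt ℝ s x)
    (hVs : V =ᶠ[𝓝[N] x] fun y => A (s y) y) (hu : u ∈ tangentSet N x) :
    fderiv ℝ V x u = A (fderiv ℝ s x u) x + A (s x) u := by
  have hA : HasFDerivAt (fun y => A (s y) y) _ x :=
    (A.hasFDerivAt.comp x hs.hasFDerivAt).clm_apply (hasFDerivAt_id x)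
  rw [fderiv_apply_eq_of_mem_tangentSet hV hA.differentiableAt hVs hu, hA.fderiv, add_comm]
  rfl

theorem lieBracket_mem_actionDist (comm : ∀ c d y, A c (A d y) = A d (A c y)) (hx : x ∈ N)
    (hV : DifferentiableAt ℝ V x) (hW : DifferentiableAt ℝ W x)
    (hs : DifferentiableAt ℝ s x) (hr : DifferentiableAt ℝ r x)
    (hVs : V =ᶠ[𝓝[N] x] fun y => A (s y) y) (hWr : W =ᶠ[𝓝[N] x] fun y => A (r y) y)
    (hVN : V x ∈ tangentSet N x) (hWN : W x ∈ tangentSet N x) :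
    VectorField.lieBracket ℝ V W x ∈ actionDist A x := by
  refine ⟨fderiv ℝ r x (V x) - fderiv ℝ s x (W x), ?_⟩
  rw [VectorField.lieBracket, fderiv_section_apply hW hr hWr hVN,
    fderiv_section_apply hV hs hVs hWN, hVs.eq_of_nhdsWithin hx, hWr.eq_of_nhdsWithin hx,
    comm (r x), add_sub_add_right_eq_sub]
  simp

theorem isSmoothFoliation_of_tangentDist_eq [FiniteDimensional ℝ F]
    (comm : ∀ c d y, A c (A d y) = A d (A c y))
    (injective : ∀ y ∈ N, Function.Injective (A.flip y))
    (tangent : ∀ y ∈ N, (actionDist A y : Set E) ⊆ tangentSet N y)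
    (hleaf : ∀ y ∈ N, tangentDist leaf y = actionDist A y)
    (leaf_eq : ∀ y ∈ N, leaf y = accessibleSet N (tangentDist leaf) y) :
    IsSmoothFoliation N (Module.finrank ℝ F) leaf where
  smooth x _ := by
    let b := Module.finBasis ℝ F
    refine ⟨fun i y => A (b i) y, fun i => (A (b i)).contDiff.contDiffAt, ?_⟩
    filter_upwards [self_mem_nhdsWithin] with y hy
    refine ⟨b.linearIndependent.map' (A.flip y).toLinearMap
      (LinearMap.ker_eq_bot.2 (injective y hy)), ?_⟩
    have range_eq : (Set.range fun i => A (b i) y) = A.flip y '' Set.range b :=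
      Set.range_comp (A.flip y) b
    rw [hleaf y hy, range_eq, ← ContinuousLinearMap.coe_coe, Submodule.span_image, b.span_eq,
      Submodule.map_top]
    rfl
  involutive x hx V W hV hW := by
    have hVA := (isSectionAt_congr hleaf).1 hV
    have hWA := (isSectionAt_congr hleaf).1 hW
    have hVd := hVA.1.differentiableAt (by simp)
    have hWd := hWA.1.differentiableAt (by simp)
    obtain ⟨s, hs, hVs⟩ := exists_differentiableAt_coeff (injective x hx) hVd hVA.2
    obtain ⟨r, hr, hWr⟩ := exists_differentiableAt_coeff (injective x hx) hWd hWA.2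
    rw [hleaf x hx]
    exact lieBracket_mem_actionDist comm hx hVd hWd hs hr hVs hWr
      (tangent x hx (hVA.2.self_of_nhdsWithin hx)) (tangent x hx (hWA.2.self_of_nhdsWithin hx))
  leaf_eq := leaf_eq

end LinearAction

/-! ### Killing fields, Riemannian foliations and totally geodesic foliations -/

section Metric

variable {E F : Type*} [NormedAddCommGroup E] [NormedSpace ℝ E]
  [NormedAddCommGroup F] [NormedSpace ℝ F]
  {G : E → E →L[ℝ] E →L[ℝ] ℝ} {N : Set E} {leaf leafO leafF : E → Set E} {x v : E}

/-- The linear vector field `y ↦ B y` is Killing at `x` for the metric `G`: the Lie derivative of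
`G` along it vanishes at `x`. -/
def IsKillingAt (G : E → E →L[ℝ] E →L[ℝ] ℝ) (B : E →L[ℝ] E) (x : E) : Prop :=
  ∀ u v, fderiv ℝ G x (B x) u v + G x (B u) v + G x u (B v) = 0

theorem isKillingAt_of_hasDerivAt {Φ : ℝ → E →L[ℝ] E} {B : E →L[ℝ] E}
    (hG : DifferentiableAt ℝ G x) (hΦ0 : Φ 0 = .id ℝ E) (hΦ : HasDerivAt Φ B 0)
    (hinv : ∀ t u v, G (Φ t x) (Φ t u) (Φ t v) = G x u v) : IsKillingAt G B x := by
  intro u v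
  have orbit (w : E) : HasDerivAt (fun t => Φ t w) (B w) 0 := by
    simpa using hΦ.clm_apply (hasDerivAt_const (0 : ℝ) w)
  have hGx : HasFDerivAt G (fderiv ℝ G x) (Φ 0 x) := by
    rw [hΦ0]
    exact hG.hasFDerivAt
  have hGΦ : HasDerivAt (fun t => G (Φ t x)) (fderiv ℝ G x (B x)) 0 :=
    HasFDerivAt.comp_hasDerivAt (E := E →L[ℝ] E →L[ℝ] ℝ) 0 hGx (orbit x)
  have pullback := (hGΦ.clm_apply (orbit u)).clm_apply (orbit v)
  simp only [hinv, hΦ0, add_apply, ContinuousLinearMap.id_apply] at pullback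
  exact pullback.unique (hasDerivAt_const 0 _)

theorem fderiv_metric_apply {Y Z : E → E} (hG : DifferentiableAt ℝ G x)
    (hY : DifferentiableAt ℝ Y x) (hZ : DifferentiableAt ℝ Z x) (v : E) :
    fderiv ℝ (fun y => G y (Y y) (Z y)) x v =
      fderiv ℝ G x v (Y x) (Z x) + G x (fderiv ℝ Y x v) (Z x) + G x (Y x) (fderiv ℝ Z x v) := by
  have h := (hG.hasFDerivAt.clm_apply hY.hasFDerivAt).clm_apply hZ.hasFDerivAt
  rw [h.fderiv]
  simp only [add_apply, ContinuousLinearMap.flip_apply, ContinuousLinearMap.comp_apply]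
  ring

theorem lieDerivMetric_eq {X Y Z : E → E} (hG : DifferentiableAt ℝ G x)
    (hY : DifferentiableAt ℝ Y x) (hZ : DifferentiableAt ℝ Z x) :
    lieDerivMetric (fun y u v => G y u v) X Y Z x = fderiv ℝ G x (X x) (Y x) (Z x) +
      G x (fderiv ℝ X x (Y x)) (Z x) + G x (Y x) (fderiv ℝ X x (Z x)) := by
  simp only [lieDerivMetric, fderiv_metric_apply hG hY hZ, VectorField.lieBracket, map_sub,
    sub_apply]
  ring

theorem isRiemannianFoliation_of_isKillingAt [FiniteDimensional ℝ F] {A : F →L[ℝ] E →L[ℝ] E}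
    (hG : ∀ y ∈ N, DifferentiableAt ℝ G y) (symm : ∀ y u v, G y u v = G y v u)
    (injective : ∀ y ∈ N, Function.Injective (A.flip y))
    (hleaf : ∀ y ∈ N, tangentDist leaf y = actionDist A y)
    (killing : ∀ y ∈ N, ∀ c, IsKillingAt G (A c) y) :
    IsRiemannianFoliation (fun y u v => G y u v) N leaf := by
  intro x hx X Y Z hX hY hZ
  have hXA := (isSectionAt_congr hleaf).1 hX
  have hXd := hXA.1.differentiableAt (by simp)
  obtain ⟨s, hs, hXs⟩ := exists_differentiableAt_coeff (injective x hx) hXd hXA.2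
  obtain ⟨hYN, hYO⟩ := hY.2.self_of_nhdsWithin hx
  obtain ⟨hZN, hZO⟩ := hZ.2.self_of_nhdsWithin hx
  have mem_leaf (c : F) : A c x ∈ tangentDist leaf x := (hleaf x hx).symm ▸ ⟨c, rfl⟩
  have orthogonal_Y (c : F) : G x (A c x) (Y x) = 0 := hYO _ (mem_leaf c)
  have orthogonal_Z (c : F) : G x (A c x) (Z x) = 0 := hZO _ (mem_leaf c)
  have fderiv_Y : G x (fderiv ℝ X x (Y x)) (Z x) = G x (A (s x) (Y x)) (Z x) := by
    rw [fderiv_section_apply hXd hs hXs hYN, map_add, add_apply,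
      orthogonal_Z, zero_add]
  have fderiv_Z : G x (Y x) (fderiv ℝ X x (Z x)) = G x (Y x) (A (s x) (Z x)) := by
    rw [fderiv_section_apply hXd hs hXs hZN, map_add, symm x (Y x), orthogonal_Y, zero_add]
  rw [lieDerivMetric_eq (hG x hx) (hY.1.differentiableAt (by simp))
    (hZ.1.differentiableAt (by simp)), fderiv_Y, fderiv_Z, hXs.eq_of_nhdsWithin hx]
  exact killing x hx (s x) (Y x) (Z x)

theorem fderiv_metric_apply_eq_zero {Y Z : E → E} (hG : DifferentiableAt ℝ G x)
    (hY : DifferentiableAt ℝ Y x) (hZ : DifferentiableAt ℝ Z x)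
    (h : ∀ᶠ y in 𝓝[N] x, G y (Y y) (Z y) = 0) (hv : v ∈ tangentSet N x) :
    fderiv ℝ (fun y => G y (Y y) (Z y)) x v = 0 := by
  have hd : DifferentiableAt ℝ (fun y => G y (Y y) (Z y)) x := (hG.clm_apply hY).clm_apply hZ
  rw [fderiv_apply_eq_of_mem_tangentSet hd (differentiableAt_const 0) h hv]
  simp

/-- For `Y`, `Z` orthogonal to `X` along `N`, the Koszul formula reads
`2 g(∇_Y Z, X) = g([Y, Z], X) - (L_X g)(Y, Z)`. -/
theorem isTotallyGeodesicFoliation_of_isRiemannianFoliation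
    (hG : ∀ y ∈ N, DifferentiableAt ℝ G y) (symm : ∀ y u v, G y u v = G y v u)
    (riemannian : IsRiemannianFoliation (fun y u v => G y u v) N leafO)
    (involutive : ∀ y ∈ N, ∀ Y Z : E → E, IsSectionAt N (tangentDist leafF) Y y →
      IsSectionAt N (tangentDist leafF) Z y →
      VectorField.lieBracket ℝ Y Z y ∈ tangentDist leafF y)
    (tangentDist_eq : ∀ y ∈ N, tangentDist leafF y = normalDist (fun y u v => G y u v) N leafO y)
    (normalDist_eq : ∀ y ∈ N, normalDist (fun y u v => G y u v) N leafF y = tangentDist leafO y) :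
    IsTotallyGeodesicFoliation (fun y u v => G y u v) N leafF := by
  intro x hx Y Z X hY hZ hX
  have hYn := (isSectionAt_congr tangentDist_eq).1 hY
  have hZn := (isSectionAt_congr tangentDist_eq).1 hZ
  have hYd := hY.1.differentiableAt (by simp)
  have hZd := hZ.1.differentiableAt (by simp)
  have hXd := hX.1.differentiableAt (by simp)
  have orthogonal_Z : ∀ᶠ y in 𝓝[N] x, G y (Z y) (X y) = 0 := by
    filter_upwards [hX.2, hZ.2] with y hXy hZy using hXy.2 _ hZy
  have orthogonal_Y : ∀ᶠ y in 𝓝[N] x, G y (X y) (Y y) = 0 := by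
    filter_upwards [hX.2, hY.2] with y hXy hYy using (symm y _ _).trans (hXy.2 _ hYy)
  have bracket_orthogonal : G x (VectorField.lieBracket ℝ Y Z x) (X x) = 0 :=
    (hX.2.self_of_nhdsWithin hx).2 _ (involutive x hx Y Z hY hZ)
  have lieDeriv_eq_zero : lieDerivMetric (fun y u v => G y u v) X Y Z x = 0 :=
    riemannian x hx X Y Z ((isSectionAt_congr normalDist_eq).1 hX) hYn hZn
  have swap (V : E → E) (w : E) : G x (VectorField.lieBracket ℝ V X x) w =
      -G x (VectorField.lieBracket ℝ X V x) w := by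
    rw [VectorField.lieBracket_swap, map_neg, neg_apply]
  simp only [lieDerivMetric] at lieDeriv_eq_zero
  simp only [leviCivita, swap, bracket_orthogonal,
    fderiv_metric_apply_eq_zero (hG x hx) hZd hXd orthogonal_Z (hYn.2.self_of_nhdsWithin hx).1,
    fderiv_metric_apply_eq_zero (hG x hx) hXd hYd orthogonal_Y (hZn.2.self_of_nhdsWithin hx).1]
  rw [symm x (Y x)] at lieDeriv_eq_zero
  linarith

end Metric

/-! ### The Kähler metrics -/

namespace KahlerGeometry

variable {ι : Type*} [Fintype ι] (X : KahlerGeometry) {z u v w : EuclideanSpace ℂ ι}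
  {D : Submodule ℝ (EuclideanSpace ℂ ι)}

theorem one_add_sign_mul_norm_sq_pos (hz : z ∈ X.domain ι) : 0 < 1 + X.sign * ‖z‖ ^ 2 := by
  cases X with
  | projective => simp only [sign]; positivity
  | hyperbolic =>
    have norm_lt_one : ‖z‖ < 1 := by simpa [domain] using hz
    simp only [sign]
    nlinarith [norm_nonneg z]

theorem isOpen_domain : IsOpen (X.domain ι) := by
  cases X with
  | projective => exact isOpen_univ
  | hyperbolic => exact Metric.isOpen_ball

theorem hermitian_add_left : X.hermitian z (u + v) w = X.hermitian z u w + X.hermitian z v w := by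
  simp only [hermitian, inner_add_right]
  ring

theorem hermitian_smul_left (a : ℂ) : X.hermitian z (a • u) v = a * X.hermitian z u v := by
  simp only [hermitian, inner_smul_right]
  ring

theorem hermitian_conj_symm : starRingEnd ℂ (X.hermitian z u v) = X.hermitian z v u := by
  simp only [hermitian, map_div₀, map_sub, map_mul, map_pow, inner_conj_symm, Complex.conj_ofReal]
  ring

theorem hermitian_smul_smul (a : ℂ) :
    X.hermitian z (a • u) (a • v) = (‖a‖ ^ 2 : ℝ) * X.hermitian z u v := by
  rw [hermitian_smul_left, ← hermitian_conj_symm, hermitian_smul_left, map_mul,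
    hermitian_conj_symm, ← mul_assoc, Complex.mul_conj', Complex.ofReal_pow]

theorem metric_comm (u v : EuclideanSpace ℂ ι) : X.metric z u v = X.metric z v u := by
  rw [metric, ← hermitian_conj_symm, Complex.conj_re, metric]

theorem metric_add_left (u v w : EuclideanSpace ℂ ι) :
    X.metric z (u + v) w = X.metric z u w + X.metric z v w := by
  simp only [metric, hermitian_add_left, Complex.add_re, mul_add]

theorem metric_smul_left (a : ℝ) (u v : EuclideanSpace ℂ ι) :
    X.metric z (a • u) v = a • X.metric z u v := by
  rw [metric, ← Complex.coe_smul, hermitian_smul_left, Complex.re_ofReal_mul, metric, smul_eq_mul,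
    mul_left_comm]

theorem form_eq_metric : X.form z u v = X.metric z (Complex.I • u) v := by
  simp [form, metric, hermitian_smul_left]

theorem metric_I_smul_right : X.metric z u (Complex.I • v) = X.form z v u := by
  rw [metric_comm, form_eq_metric]

/-- The metric at `z` as a continuous real bilinear form. -/
noncomputable def metricCLM (z : EuclideanSpace ℂ ι) :
    EuclideanSpace ℂ ι →L[ℝ] EuclideanSpace ℂ ι →L[ℝ] ℝ :=
  LinearMap.toContinuousBilinearMap <|
    LinearMap.mk₂ ℝ (X.metric z) X.metric_add_left X.metric_smul_left
      (fun u v w => by simp only [X.metric_comm u, X.metric_add_left])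
      (fun a u v => by simp only [X.metric_comm u, X.metric_smul_left])

theorem differentiableAt_metricCLM (hz : z ∈ X.domain ι) :
    DifferentiableAt ℝ X.metricCLM z := by
  have hermitian_smooth (u v : EuclideanSpace ℂ ι) :
      ContDiffOn ℝ 1 (fun y => X.hermitian y u v) (X.domain ι) := by
    have denom_smooth : ContDiff ℝ 1 fun y : EuclideanSpace ℂ ι =>
        ((1 + X.sign * ‖y‖ ^ 2 : ℝ) : ℂ) :=
      Complex.ofRealCLM.contDiff.comp (contDiff_const.add (contDiff_const.mul (contDiff_norm_sq ℂ)))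
    have inner_smooth : ContDiff ℝ 1 fun y => inner ℂ y u * inner ℂ v y :=
      (contDiff_id.inner ℂ contDiff_const).mul (contDiff_const.inner ℂ contDiff_id)
    have numerator_smooth := (denom_smooth.mul (contDiff_const (c := inner ℂ v u))).sub
      (contDiff_const (c := (X.sign : ℂ)).mul inner_smooth)
    simp only [hermitian, div_eq_mul_inv]
    refine numerator_smooth.contDiffOn.mul ((denom_smooth.pow 2).contDiffOn.inv fun y hy => ?_)
    exact pow_ne_zero 2 (Complex.ofReal_ne_zero.2 (X.one_add_sign_mul_norm_sq_pos hy).ne')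
  have metric_smooth : ContDiffOn ℝ 1 X.metricCLM (X.domain ι) :=
    contDiffOn_clm_apply.2 fun u => contDiffOn_clm_apply.2 fun v =>
      contDiffOn_const.mul (Complex.reCLM.contDiff.comp_contDiffOn (hermitian_smooth u v))
  exact (metric_smooth.contDiffAt (X.isOpen_domain.mem_nhds hz)).differentiableAt one_ne_zero

theorem hermitian_self : X.hermitian z u u = (((1 + X.sign * ‖z‖ ^ 2) * ‖u‖ ^ 2
    - X.sign * ‖inner ℂ z u‖ ^ 2) / (1 + X.sign * ‖z‖ ^ 2) ^ 2 : ℝ) := by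
  have inner_mul_inner : inner ℂ z u * inner ℂ u z = ((‖inner ℂ z u‖ ^ 2 : ℝ) : ℂ) := by
    rw [← inner_conj_symm u z, Complex.mul_conj', Complex.ofReal_pow]
  rw [hermitian, inner_mul_inner, inner_self_eq_norm_sq_to_K]
  push_cast
  rfl

theorem metric_self_pos (hz : z ∈ X.domain ι) (hu : u ≠ 0) : 0 < X.metric z u u := by
  have hp := X.one_add_sign_mul_norm_sq_pos hz
  have norm_sq_pos : 0 < ‖u‖ ^ 2 := by positivity
  rw [metric, hermitian_self, Complex.ofReal_re]
  refine mul_pos two_pos (div_pos ?_ (by positivity))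
  cases X with
  | projective =>
    have cauchy_schwarz : ‖inner ℂ z u‖ ^ 2 ≤ (‖z‖ * ‖u‖) ^ 2 :=
      pow_le_pow_left₀ (norm_nonneg _) (norm_inner_le_norm z u) 2
    simp only [sign]
    nlinarith
  | hyperbolic =>
    simp only [sign] at hp ⊢
    nlinarith [mul_pos hp norm_sq_pos, sq_nonneg ‖inner ℂ z u‖]

theorem forall_metric_eq_zero_iff (hz : z ∈ X.domain ι)
    (isotropic : ∀ u ∈ D, ∀ v ∈ D, X.form z u v = 0) (hu : u ∈ D) (hv : v ∈ D) :
    (∀ w ∈ D, X.metric z w (u + Complex.I • v) = 0) ↔ u = 0 := by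
  have metric_eq : ∀ w ∈ D, X.metric z w (u + Complex.I • v) = X.metric z w u := fun w hw => by
    rw [X.metric_comm, metric_add_left, X.metric_comm _ w, X.metric_comm _ w, metric_I_smul_right,
      isotropic v hv w hw, add_zero]
  refine ⟨fun h => ?_, ?_⟩
  · by_contra hne
    exact (X.metric_self_pos hz hne).ne' ((metric_eq u hu).symm.trans (h u hu))
  · rintro rfl w hw
    rw [metric_eq w hw]
    exact map_zero (X.metricCLM z w)

/-! ### Invariance under the unitary group -/

variable (U : EuclideanSpace ℂ ι →ₗᵢ[ℂ] EuclideanSpace ℂ ι)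

theorem metric_map : X.metric (U z) (U u) (U v) = X.metric z u v := by
  simp only [metric, hermitian, U.inner_map_map, U.norm_map]

theorem map_mem_domain_iff : U z ∈ X.domain ι ↔ z ∈ X.domain ι := by
  cases X with
  | projective => exact Iff.rfl
  | hyperbolic => simp only [domain, mem_ball_zero_iff, U.norm_map]

end KahlerGeometry

/-! ### The action of the diagonal group on the fibers -/

section BlockScale

variable {l : ℕ} {k : Fin l → ℕ}

/-- The linear action `c · z = (c_1 z_(1), …, c_l z_(l))` of the Lie algebra `ℂ^l` of `A_k` on
`ℂⁿ`, as a continuous bilinear map. Its restriction to nonzero `c_j` is the action of `A_k`. -/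
noncomputable def blockScale : (Fin l → ℂ) →L[ℂ] Cn k →L[ℂ] Cn k :=
  LinearMap.toContinuousBilinearMap <|
    LinearMap.mk₂ ℂ (fun c z => WithLp.toLp 2 fun i => c i.1 * z i)
      (fun c d z => by ext i; exact add_mul _ _ _) (fun a c z => by ext i; exact mul_assoc _ _ _)
      (fun c z w => by ext i; exact mul_add _ _ _)
      (fun a c z => by ext i; exact mul_left_comm _ _ _)

@[simp] theorem blockScale_apply (c : Fin l → ℂ) (z : Cn k) (i : Σ j, Fin (k j)) :
    blockScale c z i = c i.1 * z i := rfl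

theorem blockScale_mul (c d : Fin l → ℂ) (z : Cn k) :
    blockScale (c * d) z = blockScale c (blockScale d z) := by
  ext i
  exact mul_assoc _ _ _

theorem smul_blockScale (b : CStar k) (c : Fin l → ℂ) (z : Cn k) :
    b • blockScale c z = blockScale c (b • z) := by
  ext i
  exact mul_left_comm _ _ _

/-- The complex span of the blocks of `z`, which is the tangent space at `z` of the fiber of `π_k`
through `z`. -/
noncomputable def blockSpan (z : Cn k) : Submodule ℂ (Cn k) :=
  LinearMap.range (blockScale.flip z).toLinearMap

variable {X : KahlerGeometry} {p : ProjProd k} {z w : Cn k} {c : Fin l → ℂ}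

theorem exists_coord_ne_zero (hz : z ∈ Vk k) :
    ∃ a : ∀ j, Fin (k j), ∀ j, z ⟨j, a j⟩ ≠ 0 := by
  choose a ha using fun j => Function.ne_iff.1 (hz j)
  exact ⟨a, ha⟩

theorem blockScale_left_injective (hz : z ∈ Vk k) : Function.Injective (blockScale.flip z) := by
  obtain ⟨a, ha⟩ := exists_coord_ne_zero hz
  intro c d h
  funext j
  exact mul_right_cancel₀ (ha j) (congrArg (fun w : Cn k => w ⟨j, a j⟩) h)

theorem ne_zero_of_blockScale_mem_Vk (h : blockScale c z ∈ Vk k) (j : Fin l) : c j ≠ 0 := by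
  obtain ⟨a, ha⟩ := exists_coord_ne_zero h
  exact left_ne_zero_of_mul (ha j)

theorem mem_fiber_iff (hz : z ∈ fiber X p) :
    w ∈ fiber X p ↔ w ∈ X.domain _ ∧ ∃ c : Fin l → ℂ, (∀ j, c j ≠ 0) ∧ blockScale c z = w := by
  obtain ⟨hzV, rfl, -⟩ := hz
  constructor
  · rintro ⟨hwV, hw, hwX⟩
    obtain ⟨g, hg⟩ := (projPi_eq_iff ⟨z, hzV⟩ ⟨w, hwV⟩).1 hw.symm
    exact ⟨hwX, fun j => g j, fun j => (g j).ne_zero, congrArg Subtype.val hg⟩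
  · rintro ⟨hwX, c, hc, rfl⟩
    let g : Fin l → ℂˣ := fun j => Units.mk0 (c j) (hc j)
    exact ⟨(g • (⟨z, hzV⟩ : Vk k)).2, projPi_blockDiag_smul g ⟨z, hzV⟩, hwX⟩

theorem eventually_mem_fiber_iff (hz : z ∈ fiber X p) :
    ∀ᶠ w in 𝓝 z, w ∈ fiber X p ↔ w ∈ blockSpan z := by
  filter_upwards [(Vk k).isOpen.mem_nhds hz.1, X.isOpen_domain.mem_nhds hz.2.2] with w hwV hwX
  rw [mem_fiber_iff hz, and_iff_right hwX]
  constructor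
  · rintro ⟨c, -, hc⟩
    exact ⟨c, hc⟩
  · rintro ⟨c, rfl⟩
    exact ⟨c, ne_zero_of_blockScale_mem_Vk hwV, rfl⟩

theorem finrank_blockSpan (hz : z ∈ Vk k) : Module.finrank ℂ (blockSpan z) = l := by
  rw [blockSpan, LinearMap.finrank_range_of_inj (blockScale_left_injective hz),
    Module.finrank_fin_fun]

theorem isComplexSubmanifold_fiber (X : KahlerGeometry) (p : ProjProd k) :
    IsComplexSubmanifold l (fiber X p) :=
  isComplexSubmanifold_of_eventually_mem_iff fun z hz =>
    ⟨blockSpan z, finrank_blockSpan hz.1, eventually_mem_fiber_iff hz⟩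

theorem mem_blockSpan_self (z : Cn k) : z ∈ blockSpan z :=
  ⟨1, by ext i; exact one_mul _⟩

theorem tangentSet_fiber (hz : z ∈ fiber X p) : tangentSet (fiber X p) z = blockSpan z :=
  tangentSet_eq_submodule (S := (blockSpan z).restrictScalars ℝ)
    (Submodule.closed_of_finiteDimensional _) (mem_blockSpan_self z) (eventually_mem_fiber_iff hz)

end BlockScale

/-! ### Real forms of the infinitesimal action -/

section BlockDist

variable {l : ℕ} {k : Fin l → ℕ} {X : KahlerGeometry} {p : ProjProd k} {e : ℂ} {z u v : Cn k}

/-- The embedding `s ↦ e s` of `ℝ^l` into `ℂ^l`. -/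
noncomputable def realCoeff (e : ℂ) : (Fin l → ℝ) →L[ℝ] (Fin l → ℂ) :=
  ContinuousLinearMap.pi fun j => e • (Complex.ofRealCLM ∘L ContinuousLinearMap.proj j)

@[simp] theorem realCoeff_apply (s : Fin l → ℝ) (j : Fin l) : realCoeff e s j = e * s j := rfl

theorem realCoeff_injective (he : e ≠ 0) : Function.Injective (realCoeff (l := l) e) :=
  fun _ _ h => funext fun j => Complex.ofReal_injective (mul_left_cancel₀ he (congrFun h j))

/-- The infinitesimal action of the real form `e ℝ^l` of `ℂ^l`. For `e = i` it generates the
orbits of `T_k`, and for `e = 1` the leaves orthogonal to them. -/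
noncomputable def realBlockScale (e : ℂ) : (Fin l → ℝ) →L[ℝ] Cn k →L[ℝ] Cn k :=
  (ContinuousLinearMap.restrictScalarsL ℂ (Cn k) (Cn k) ℝ ℝ ∘L blockScale.restrictScalars ℝ) ∘L
    realCoeff e

@[simp] theorem realBlockScale_apply (s : Fin l → ℝ) (z : Cn k) :
    realBlockScale e s z = blockScale (realCoeff e s) z := rfl

theorem realBlockScale_comm (s r : Fin l → ℝ) (z : Cn k) :
    realBlockScale e s (realBlockScale e r z) = realBlockScale e r (realBlockScale e s z) := by
  ext i
  exact mul_left_comm _ _ _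

theorem realBlockScale_left_injective (he : e ≠ 0) (hz : z ∈ Vk k) :
    Function.Injective ((realBlockScale e).flip z) :=
  (blockScale_left_injective hz).comp (realCoeff_injective he)

/-- The distribution spanned by the vectors `e z_(1), …, e z_(l)` over `ℝ`. -/
noncomputable abbrev blockDist (e : ℂ) (z : Cn k) : Submodule ℝ (Cn k) :=
  actionDist (realBlockScale e) z

theorem smul_blockScale_realCoeff (a : ℂ) (s : Fin l → ℝ) :
    a • blockScale (realCoeff e s) z = blockScale (realCoeff (a * e) s) z := by
  ext i
  simp [mul_assoc]

theorem mem_blockDist_mul (a : ℂ) : v ∈ blockDist (a * e) z ↔ ∃ u ∈ blockDist e z, a • u = v := by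
  constructor
  · rintro ⟨s, rfl⟩
    exact ⟨_, ⟨s, rfl⟩, smul_blockScale_realCoeff a s⟩
  · rintro ⟨_, ⟨s, rfl⟩, rfl⟩
    exact ⟨s, (smul_blockScale_realCoeff a s).symm⟩

theorem blockDist_neg (e : ℂ) (z : Cn k) : blockDist (-e) z = blockDist e z := by
  ext v
  rw [← neg_one_mul, mem_blockDist_mul]
  constructor
  · rintro ⟨u, hu, rfl⟩
    simpa using hu
  · exact fun hv => ⟨-v, neg_mem hv, by simp⟩

theorem mem_blockSpan_iff (he : e ≠ 0) :
    v ∈ blockSpan z ↔ ∃ u ∈ blockDist e z, ∃ w ∈ blockDist e z, u + Complex.I • w = v := by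
  constructor
  · rintro ⟨c, rfl⟩
    refine ⟨_, ⟨fun j => (c j / e).re, rfl⟩, _, ⟨fun j => (c j / e).im, rfl⟩, ?_⟩
    ext i
    have re_add_im : (e * (c i.1 / e).re + Complex.I * (e * (c i.1 / e).im)) = c i.1 := by
      rw [mul_left_comm, ← mul_add, mul_comm Complex.I, Complex.re_add_im, mul_div_cancel₀ _ he]
    change e * (c i.1 / e).re * z i + Complex.I * (e * (c i.1 / e).im * z i) = c i.1 * z i
    rw [← mul_assoc, ← add_mul, re_add_im]
  · rintro ⟨_, ⟨s, rfl⟩, _, ⟨r, rfl⟩, rfl⟩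
    exact add_mem ⟨_, rfl⟩ ((blockSpan z).smul_mem _ ⟨_, rfl⟩)

theorem inner_blockScale_ofReal (s r : Fin l → ℝ) (z : Cn k) :
    inner ℂ (blockScale (realCoeff 1 s) z) (blockScale (realCoeff 1 r) z) =
      (∑ i, s i.1 * r i.1 * ‖z i‖ ^ 2 : ℝ) := by
  simp only [PiLp.inner_apply, blockScale_apply, realCoeff_apply, one_mul, RCLike.inner_apply,
    map_mul, Complex.conj_ofReal]
  push_cast
  refine Finset.sum_congr rfl fun i _ => ?_
  rw [← Complex.mul_conj']
  ring

theorem hermitian_blockScale_ofReal_im (X : KahlerGeometry) (s r : Fin l → ℝ) (z : Cn k) :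
    (X.hermitian z (blockScale (realCoeff 1 s) z) (blockScale (realCoeff 1 r) z)).im = 0 := by
  have scale_one : blockScale (realCoeff 1 1) z = z := by
    ext i
    simp
  have inner_left := inner_blockScale_ofReal 1 s z
  have inner_right := inner_blockScale_ofReal r 1 z
  rw [scale_one] at inner_left inner_right
  rw [KahlerGeometry.hermitian, inner_blockScale_ofReal, inner_left, inner_right]
  norm_cast

theorem form_eq_zero_of_mem_blockDist (hu : u ∈ blockDist e z) (hv : v ∈ blockDist e z) :
    X.form z u v = 0 := by
  rw [← mul_one e, mem_blockDist_mul] at hu hv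
  obtain ⟨_, ⟨s, rfl⟩, rfl⟩ := hu
  obtain ⟨_, ⟨r, rfl⟩, rfl⟩ := hv
  rw [KahlerGeometry.form, KahlerGeometry.hermitian_smul_smul, Complex.im_ofReal_mul]
  simp only [realBlockScale_apply, ContinuousLinearMap.coe_coe, ContinuousLinearMap.flip_apply,
    hermitian_blockScale_ofReal_im, mul_zero]

theorem orthogonal_blockDist (he : e ≠ 0) (hz : z ∈ fiber X p) :
    {v ∈ tangentSet (fiber X p) z | ∀ u ∈ blockDist e z, X.metric z u v = 0} =
      blockDist (Complex.I * e) z := by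
  have isotropic : ∀ u ∈ blockDist e z, ∀ v ∈ blockDist e z, X.form z u v = 0 :=
    fun u hu v hv => form_eq_zero_of_mem_blockDist hu hv
  ext v
  rw [tangentSet_fiber hz, Set.mem_ofPred_eq, SetLike.mem_coe, SetLike.mem_coe,
    mem_blockSpan_iff he, mem_blockDist_mul]
  constructor
  · rintro ⟨⟨u, hu, w, hw, rfl⟩, orthogonal⟩
    rw [X.forall_metric_eq_zero_iff hz.2.2 isotropic hu hw] at orthogonal
    exact ⟨w, hw, by rw [orthogonal, zero_add]⟩
  · rintro ⟨w, hw, rfl⟩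
    rw [← zero_add (Complex.I • w), X.forall_metric_eq_zero_iff hz.2.2 isotropic (zero_mem _) hw]
    exact ⟨⟨0, zero_mem _, w, hw, rfl⟩, rfl⟩

theorem form_orthogonal_blockDist (he : e ≠ 0) (hz : z ∈ fiber X p) :
    {v ∈ tangentSet (fiber X p) z | ∀ u ∈ blockDist e z, X.form z u v = 0} = blockDist e z := by
  have rotate (v : Cn k) : (∀ u ∈ blockDist e z, X.form z u v = 0) ↔
      ∀ u ∈ blockDist (Complex.I * e) z, X.metric z u v = 0 := by
    simp only [mem_blockDist_mul, forall_exists_index, and_imp, forall_apply_eq_imp_iff₂,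
      X.form_eq_metric]
  simp only [rotate]
  rw [orthogonal_blockDist (mul_ne_zero Complex.I_ne_zero he) hz, ← mul_assoc, Complex.I_mul_I,
    neg_one_mul, blockDist_neg]

end BlockDist

/-! ### The exponential flow and its leaves -/

section ExpLeaf

variable {l : ℕ} {k : Fin l → ℕ} {X : KahlerGeometry} {p : ProjProd k} {e : ℂ} {z w v : Cn k}
  {c : Fin l → ℂ}

/-- The action of `(exp c_1, …, exp c_l) ∈ A_k` on `ℂⁿ`, that is, the time-one flow of the linear
vector field `blockScale c`. -/
noncomputable def blockExp (c : Fin l → ℂ) : Cn k →L[ℂ] Cn k :=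
  blockScale fun j => Complex.exp (c j)

@[simp] theorem blockExp_apply (c : Fin l → ℂ) (z : Cn k) (i : Σ j, Fin (k j)) :
    blockExp c z i = Complex.exp (c i.1) * z i := rfl

theorem blockExp_zero : blockExp (0 : Fin l → ℂ) = .id ℂ (Cn k) := by
  ext z i
  simp

theorem blockExp_add (c d : Fin l → ℂ) (z : Cn k) :
    blockExp (c + d) z = blockExp c (blockExp d z) := by
  ext i
  simp [Complex.exp_add, mul_assoc]

theorem contDiff_blockExp_smul (c : Fin l → ℂ) (z : Cn k) {m : WithTop ℕ∞} :
    ContDiff ℝ m fun t : ℝ => blockExp (t • c) z := by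
  have coeff_smooth : ContDiff ℝ m fun (t : ℝ) (j : Fin l) => Complex.exp ((t • c) j) :=
    contDiff_pi.2 fun j => (contDiff_id.smul contDiff_const).cexp
  exact ((blockScale.flip z).restrictScalars ℝ).contDiff.comp coeff_smooth

theorem hasDerivAt_blockExp_smul (c : Fin l → ℂ) (t : ℝ) :
    HasDerivAt (fun t : ℝ => (blockExp (t • c) : Cn k →L[ℂ] Cn k))
      (blockScale c ∘L blockExp (t • c)) t := by
  have coeff_deriv : HasDerivAt (fun (t : ℝ) (j : Fin l) => Complex.exp ((t • c) j))
      (c * fun j => Complex.exp ((t • c) j)) t :=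
    hasDerivAt_pi.2 fun j => by
      simpa [mul_comm (c j)] using ((hasDerivAt_id t).smul_const (c j)).cexp
  refine ((blockScale.restrictScalars ℝ).hasFDerivAt.comp_hasDerivAt t coeff_deriv).congr_deriv ?_
  ext1 z
  exact blockScale_mul c _ z

theorem hasDerivAt_blockExp_smul_apply (c : Fin l → ℂ) (z : Cn k) (t : ℝ) :
    HasDerivAt (fun t : ℝ => blockExp (t • c) z) (blockScale c (blockExp (t • c) z)) t :=
  ((ContinuousLinearMap.apply ℂ (Cn k) z).restrictScalars ℝ).hasFDerivAt.comp_hasDerivAt t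
    (hasDerivAt_blockExp_smul c t)

theorem blockExp_mem_fiber (hz : z ∈ fiber X p) (h : blockExp c z ∈ X.domain _) :
    blockExp c z ∈ fiber X p :=
  (mem_fiber_iff hz).2 ⟨h, _, fun _ => Complex.exp_ne_zero _, rfl⟩

theorem convexOn_norm_sq_blockExp_smul (c : Fin l → ℂ) (z : Cn k) :
    ConvexOn ℝ Set.univ fun t : ℝ => ‖blockExp (t • c) z‖ ^ 2 := by
  have norm_sq_eq : (fun t : ℝ => ‖blockExp (t • c) z‖ ^ 2) = ∑ i, fun t =>
      ‖z i‖ ^ 2 • Real.exp (LinearMap.mulRight ℝ (2 * (c i.1).re) t) := by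
    ext t
    rw [EuclideanSpace.norm_sq_eq, Finset.sum_apply]
    refine Finset.sum_congr rfl fun i _ => ?_
    have exponent_eq : (2 : ℕ) * ((t • c) i.1).re = t * (2 * (c i.1).re) := by
      rw [Pi.smul_apply, Complex.smul_re, smul_eq_mul, Nat.cast_ofNat, mul_left_comm]
    rw [blockExp_apply, norm_mul, mul_pow, Complex.norm_exp, ← Real.exp_nat_mul, exponent_eq,
      mul_comm, smul_eq_mul, LinearMap.mulRight_apply]
  rw [norm_sq_eq]
  refine Finset.sum_induction _ (ConvexOn ℝ Set.univ) (fun _ _ => ConvexOn.add)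
    (convexOn_const 0 convex_univ) fun i _ => ConvexOn.smul (sq_nonneg _) ?_
  exact convexOn_exp.comp_linearMap (LinearMap.mulRight ℝ (2 * (c i.1).re))

theorem blockExp_smul_mem_domain (hz : z ∈ X.domain _) (h : blockExp c z ∈ X.domain _) {t : ℝ}
    (ht : t ∈ Set.Icc (0 : ℝ) 1) : blockExp (t • c) z ∈ X.domain _ := by
  cases X with
  | projective => exact Set.mem_univ _
  | hyperbolic =>
    have mem_iff (y : Cn k) : y ∈ KahlerGeometry.hyperbolic.domain _ ↔ ‖y‖ ^ 2 < 1 := by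
      simp [KahlerGeometry.domain, sq_lt_one_iff_abs_lt_one]
    rw [mem_iff] at hz h ⊢
    have sublevel_convex := (convexOn_norm_sq_blockExp_smul c z).convex_lt 1
    exact (sublevel_convex.ordConnected.out ⟨Set.mem_univ _, by simpa [blockExp_zero] using hz⟩
      ⟨Set.mem_univ _, by simpa using h⟩ ht).2

/-- The part inside the domain of the orbit of `z` under the real form `exp (e ℝ^l)` of the group
`A_k`. For `e = i` and `e = 1` these are the leaves of the two foliations of a Lagrangian frame. -/
def expLeaf (X : KahlerGeometry) (e : ℂ) (z : Cn k) : Set (Cn k) :=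
  {w ∈ X.domain _ | ∃ s : Fin l → ℝ, blockExp (realCoeff e s) z = w}

theorem mem_expLeaf_self (hz : z ∈ X.domain _) : z ∈ expLeaf X e z :=
  ⟨hz, 0, by rw [map_zero, blockExp_zero, ContinuousLinearMap.id_apply]⟩

theorem mem_expLeaf_trans (hw : w ∈ expLeaf X e z) (hv : v ∈ expLeaf X e w) :
    v ∈ expLeaf X e z := by
  obtain ⟨-, s, rfl⟩ := hw
  obtain ⟨hv, r, rfl⟩ := hv
  exact ⟨hv, r + s, by rw [map_add, blockExp_add]⟩

theorem blockDist_subset_tangentSet_expLeaf (hz : z ∈ X.domain _) :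
    (blockDist e z : Set (Cn k)) ⊆ tangentSet (expLeaf X e z) z := by
  rintro _ ⟨s, rfl⟩
  have flow_zero : blockExp ((0 : ℝ) • realCoeff e s) z = z := by
    rw [zero_smul, blockExp_zero, ContinuousLinearMap.id_apply]
  refine ⟨_, contDiff_blockExp_smul (realCoeff e s) z, flow_zero, ?_, ?_⟩
  · have flow_continuous := (contDiff_blockExp_smul (m := 0) (realCoeff e s) z).continuous
    filter_upwards [flow_continuous.continuousAt.eventually_mem
      (X.isOpen_domain.mem_nhds (flow_zero.symm ▸ hz))] with t ht
    exact ⟨ht, t • s, by rw [map_smul]⟩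
  · rw [(hasDerivAt_blockExp_smul_apply _ z 0).deriv, flow_zero]
    rfl

theorem tangentSet_expLeaf_one (hz : z ∈ X.domain _) :
    tangentSet (expLeaf X 1 z) z = blockDist 1 z := by
  refine (tangentSet_subset_submodule (Submodule.closed_of_finiteDimensional _)
    (eventually_nhdsWithin_of_forall ?_)).antisymm (blockDist_subset_tangentSet_expLeaf hz)
  rintro _ ⟨-, s, rfl⟩
  refine ⟨fun j => Real.exp (s j), ?_⟩
  ext i
  simp

theorem norm_apply_eq_of_mem_expLeaf_I (hw : w ∈ expLeaf X Complex.I z) (i : Σ j, Fin (k j)) :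
    ‖w i‖ = ‖z i‖ := by
  obtain ⟨-, s, rfl⟩ := hw
  rw [blockExp_apply, realCoeff_apply, norm_mul, Complex.norm_exp_I_mul_ofReal, one_mul]

theorem inner_apply_eq_zero_of_mem_tangentSet_expLeaf_I
    (hv : v ∈ tangentSet (expLeaf X Complex.I z) z) (i : Σ j, Fin (k j)) :
    inner ℝ (z i) (v i) = 0 := by
  let coord : Cn k →L[ℝ] ℂ := (EuclideanSpace.proj (𝕜 := ℂ) i).restrictScalars ℝ
  have norm_sq_deriv := (coord.hasFDerivAt (x := z)).norm_sq
  have norm_sq_const : (fun y => ‖coord y‖ ^ 2) =ᶠ[𝓝[expLeaf X Complex.I z] z]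
      fun _ => ‖coord z‖ ^ 2 :=
    eventually_nhdsWithin_of_forall fun y hy =>
      congrArg (· ^ 2) (norm_apply_eq_of_mem_expLeaf_I hy i)
  have deriv_eq := fderiv_apply_eq_of_mem_tangentSet norm_sq_deriv.differentiableAt
    (differentiableAt_const _) norm_sq_const hv
  rw [norm_sq_deriv.fderiv, fderiv_fun_const] at deriv_eq
  change (2 : ℕ) • inner ℝ (z i) (v i) = 0 at deriv_eq
  exact (smul_eq_zero.1 deriv_eq).resolve_left two_ne_zero

theorem tangentSet_expLeaf_I (hz : z ∈ Vk k) (hzX : z ∈ X.domain _) :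
    tangentSet (expLeaf X Complex.I z) z = blockDist Complex.I z := by
  refine Set.Subset.antisymm (fun v hv => ?_) (blockDist_subset_tangentSet_expLeaf hzX)
  have leaf_subset : ∀ y ∈ expLeaf X Complex.I z, y ∈ (blockSpan z).restrictScalars ℝ := by
    rintro _ ⟨-, s, rfl⟩
    exact ⟨fun j => Complex.exp (Complex.I * s j), rfl⟩
  obtain ⟨c, rfl⟩ := tangentSet_subset_submodule (Submodule.closed_of_finiteDimensional _)
    (eventually_nhdsWithin_of_forall leaf_subset) hv
  obtain ⟨a, ha⟩ := exists_coord_ne_zero hz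
  have re_eq_zero (j : Fin l) : (c j).re = 0 := by
    have inner_eq_zero := inner_apply_eq_zero_of_mem_tangentSet_expLeaf_I hv ⟨j, a j⟩
    change inner ℝ (z ⟨j, a j⟩) (c j * z ⟨j, a j⟩) = 0 at inner_eq_zero
    rw [Complex.inner, mul_assoc, Complex.mul_conj', ← Complex.ofReal_pow,
      Complex.re_mul_ofReal] at inner_eq_zero
    exact (mul_eq_zero.1 inner_eq_zero).resolve_right (pow_ne_zero 2 (norm_ne_zero_iff.2 (ha j)))
  refine ⟨fun j => (c j).im, ?_⟩
  ext i
  change Complex.I * (c i.1).im * z i = c i.1 * z i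
  rw [← Complex.re_add_im (c i.1), re_eq_zero, Complex.ofReal_zero, zero_add, mul_comm Complex.I]
  simp

theorem eq_exp_integral_mul {f g : ℝ → ℂ} {a b : ℝ} (hab : a ≤ b) (hg : Continuous g)
    (hf : ∀ t ∈ Set.Icc a b, HasDerivAt f (g t * f t) t) :
    f b = Complex.exp (∫ t in a..b, g t) * f a := by
  have deriv_zero : ∀ t ∈ Set.Icc a b,
      HasDerivAt (fun t => Complex.exp (-∫ τ in a..t, g τ) * f t) 0 t := fun t ht => by
    have integral_deriv := (hg.integral_hasStrictDerivAt a t).hasDerivAt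
    have product_rule := integral_deriv.fun_neg.cexp.fun_mul (hf t ht)
    exact product_rule.congr_deriv (by ring)
  have constant := constant_of_has_deriv_right_zero
    (fun t ht => (deriv_zero t ht).continuousAt.continuousWithinAt)
    (fun t ht => (deriv_zero t (Set.Ico_subset_Icc_self ht)).hasDerivWithinAt) b
    (Set.right_mem_Icc.2 hab)
  rw [intervalIntegral.integral_same, neg_zero, Complex.exp_zero, one_mul] at constant
  rw [← constant, ← mul_assoc, ← Complex.exp_add, add_neg_cancel, Complex.exp_zero, one_mul]

theorem exists_eq_exp_mul {f : ℝ → ℂ} (he : e ≠ 0) (hf : ContDiff ℝ 1 f)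
    (f_ne : ∀ t ∈ Set.Icc (0 : ℝ) 1, f t ≠ 0)
    (hf' : ∀ t ∈ Set.Icc (0 : ℝ) 1, ∃ σ : ℝ, deriv f t = e * σ * f t) :
    ∃ S : ℝ, f 1 = Complex.exp (e * S) * f 0 := by
  let σ : ℝ → ℝ := fun t => (deriv f t / (e * f t)).re
  have σ_continuous : ContinuousOn σ (Set.Icc 0 1) :=
    Complex.continuous_re.comp_continuousOn ((hf.continuous_deriv le_rfl).continuousOn.div
      (continuousOn_const.mul hf.continuous.continuousOn) fun t ht => mul_ne_zero he (f_ne t ht))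
  let σ' : ℝ → ℝ := Set.IccExtend zero_le_one ((Set.Icc (0 : ℝ) 1).domRestrict σ)
  have σ'_continuous : Continuous σ' := σ_continuous.domRestrict.Icc_extend'
  have deriv_eq : ∀ t ∈ Set.Icc (0 : ℝ) 1, HasDerivAt f (e * σ' t * f t) t := fun t ht => by
    obtain ⟨r, hr⟩ := hf' t ht
    have σ'_eq : σ' t = r := by
      rw [show σ' t = σ t from Set.IccExtend_of_mem _ _ ht]
      simp only [σ]
      rw [hr, mul_right_comm, mul_div_cancel_left₀ _ (mul_ne_zero he (f_ne t ht)),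
        Complex.ofReal_re]
    rw [σ'_eq, ← hr]
    exact (hf.differentiable one_ne_zero t).hasDerivAt
  refine ⟨∫ t in (0 : ℝ)..1, σ' t, ?_⟩
  rw [eq_exp_integral_mul zero_le_one (by fun_prop) deriv_eq, intervalIntegral.integral_const_mul,
    intervalIntegral.integral_ofReal]

theorem mem_expLeaf_of_path (he : e ≠ 0) {γ : ℝ → Cn k} (hγ : ContDiff ℝ 1 γ)
    (hfiber : ∀ t ∈ Set.Icc (0 : ℝ) 1, γ t ∈ fiber X p)
    (htangent : ∀ t ∈ Set.Icc (0 : ℝ) 1, deriv γ t ∈ blockDist e (γ t)) :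
    γ 1 ∈ expLeaf X e (γ 0) := by
  have fiber_zero := hfiber 0 (Set.left_mem_Icc.2 zero_le_one)
  have scale_of_mem : ∀ t ∈ Set.Icc (0 : ℝ) 1,
      ∃ c : Fin l → ℂ, (∀ j, c j ≠ 0) ∧ blockScale c (γ 0) = γ t :=
    fun t ht => ((mem_fiber_iff fiber_zero).1 (hfiber t ht)).2
  obtain ⟨a, ha⟩ := exists_coord_ne_zero fiber_zero.1
  have coord_deriv (i : Σ j, Fin (k j)) (t : ℝ) : HasDerivAt (fun t => γ t i) (deriv γ t i) t :=
    ((EuclideanSpace.proj (𝕜 := ℂ) i).restrictScalars ℝ).hasFDerivAt.comp_hasDerivAt t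
      (hγ.differentiable one_ne_zero t).hasDerivAt
  have coord_lift (j : Fin l) :
      ∃ S : ℝ, γ 1 ⟨j, a j⟩ = Complex.exp (e * S) * γ 0 ⟨j, a j⟩ := by
    refine exists_eq_exp_mul he (f := fun t => γ t ⟨j, a j⟩) (by fun_prop) (fun t ht => ?_)
      fun t ht => ?_
    · obtain ⟨c, hc, hct⟩ := scale_of_mem t ht
      rw [← hct]
      exact mul_ne_zero (hc j) (ha j)
    · obtain ⟨σ, hσ⟩ := htangent t ht
      exact ⟨σ j, by rw [(coord_deriv _ t).deriv, ← hσ]; rfl⟩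
  choose S hS using coord_lift
  have one_mem : (1 : ℝ) ∈ Set.Icc 0 1 := Set.right_mem_Icc.2 zero_le_one
  obtain ⟨c, -, hc⟩ := scale_of_mem 1 one_mem
  have coeff_eq : c = fun j => Complex.exp (e * S j) := funext fun j =>
    mul_right_cancel₀ (ha j) ((congrArg (fun w : Cn k => w ⟨j, a j⟩) hc).trans (hS j))
  exact ⟨(hfiber 1 one_mem).2.2, S, by rw [← hc, coeff_eq]; rfl⟩

theorem accessibleSet_fiber (he : e ≠ 0) (hz : z ∈ fiber X p) :
    accessibleSet (fiber X p) (fun w => blockDist e w) z = expLeaf X e z := by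
  refine Set.Subset.antisymm (fun w hw => ?_) ?_
  · induction hw with
    | refl => exact mem_expLeaf_self hz.2.2
    | tail _ step mem_leaf =>
      obtain ⟨γ, hγ, rfl, rfl, hγt⟩ := step
      exact mem_expLeaf_trans mem_leaf
        (mem_expLeaf_of_path he hγ (fun t ht => (hγt t ht).1) fun t ht => (hγt t ht).2)
  · rintro _ ⟨hw, s, rfl⟩
    refine Relation.ReflTransGen.single ⟨_, contDiff_blockExp_smul (realCoeff e s) z,
      by rw [zero_smul, blockExp_zero, ContinuousLinearMap.id_apply], by rw [one_smul],
      fun t ht => ⟨blockExp_mem_fiber hz (blockExp_smul_mem_domain hz.2.2 hw ht), ?_⟩⟩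
    rw [(hasDerivAt_blockExp_smul_apply _ z t).deriv]
    exact ⟨s, rfl⟩

end ExpLeaf

/-! ### The Lagrangian frame of a fiber -/

section LagrangianFrame

variable {l : ℕ} {k : Fin l → ℕ} {X : KahlerGeometry} {p : ProjProd k} {b : CStar k} {z : Cn k}

/-- The action of an element of `𝕋ⁿ` on `ℂⁿ` as a linear isometry. -/
noncomputable def torusIsometry (b : CStar k) (hb : b ∈ torus k) : Cn k →ₗᵢ[ℂ] Cn k where
  toFun z := b • z
  map_add' z w := by ext i; exact mul_add _ _ _
  map_smul' a z := by ext i; exact mul_left_comm _ _ _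
  norm_map' z := by
    change ‖b • z‖ = ‖z‖
    simp only [EuclideanSpace.norm_eq, cstar_smul_apply, norm_mul, hb _, one_mul]

theorem exists_mem_Tk_smul_eq_blockExp (s : Fin l → ℝ) :
    ∃ t ∈ Tk k, ∀ z : Cn k, t • z = blockExp (realCoeff Complex.I s) z := by
  refine ⟨blockDiag k fun j => Units.mk0 _ (Complex.exp_ne_zero (Complex.I * s j)),
    ⟨fun i => ?_, ⟨_, rfl⟩⟩, fun z => rfl⟩
  exact Complex.norm_exp_I_mul_ofReal (s i.1)

theorem exists_blockExp_eq_smul {t : CStar k} (ht : t ∈ Tk k) :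
    ∃ s : Fin l → ℝ, ∀ z : Cn k, blockExp (realCoeff Complex.I s) z = t • z := by
  obtain ⟨norm_eq_one, a, rfl⟩ := ht
  refine ⟨fun j => Complex.arg (a j), fun z => ?_⟩
  ext i
  have norm_a : ‖(a i.1 : ℂ)‖ = 1 := norm_eq_one i
  rw [blockExp_apply, realCoeff_apply, mul_comm Complex.I]
  have polar := Complex.norm_mul_exp_arg_mul_I (a i.1)
  rw [norm_a, Complex.ofReal_one, one_mul] at polar
  rw [polar]
  rfl

theorem orbitLeaf_eq_expLeaf (hz : z ∈ X.domain _) : orbitLeaf z = expLeaf X Complex.I z := by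
  ext w
  constructor
  · rintro ⟨t, ht, rfl⟩
    obtain ⟨s, hs⟩ := exists_blockExp_eq_smul ht
    exact ⟨(X.map_mem_domain_iff (torusIsometry t ht.1)).2 hz, s, hs z⟩
  · rintro ⟨-, s, rfl⟩
    obtain ⟨t, ht, hts⟩ := exists_mem_Tk_smul_eq_blockExp s
    exact ⟨t, ht, hts z⟩

theorem tangentDist_orbitLeaf (hz : z ∈ fiber X p) :
    tangentDist orbitLeaf z = blockDist Complex.I z := by
  rw [tangentDist, orbitLeaf_eq_expLeaf hz.2.2, tangentSet_expLeaf_I hz.1 hz.2.2]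

theorem normalDist_orbitLeaf (hz : z ∈ fiber X p) :
    normalDist X.metric (fiber X p) orbitLeaf z = blockDist 1 z := by
  have orthogonal := orthogonal_blockDist Complex.I_ne_zero hz
  rw [Complex.I_mul_I, blockDist_neg] at orthogonal
  rwa [normalDist, tangentDist_orbitLeaf hz]

theorem perpLeaf_eq_expLeaf (hz : z ∈ fiber X p) : perpLeaf X p z = expLeaf X 1 z := by
  rw [perpLeaf, accessibleSet_congr fun _ => normalDist_orbitLeaf,
    accessibleSet_fiber one_ne_zero hz]

theorem tangentDist_perpLeaf (hz : z ∈ fiber X p) :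
    tangentDist (perpLeaf X p) z = blockDist 1 z := by
  rw [tangentDist, perpLeaf_eq_expLeaf hz, tangentSet_expLeaf_one hz.2.2]

theorem normalDist_perpLeaf (hz : z ∈ fiber X p) :
    normalDist X.metric (fiber X p) (perpLeaf X p) z = blockDist Complex.I z := by
  rw [normalDist, tangentDist_perpLeaf hz, ← mul_one Complex.I]
  exact orthogonal_blockDist one_ne_zero hz

theorem isSmoothFoliation_fiber {e : ℂ} (he : e ≠ 0) {leaf : Cn k → Set (Cn k)}
    (hleaf : ∀ y ∈ fiber X p, leaf y = expLeaf X e y)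
    (tangent : ∀ y ∈ fiber X p, tangentDist leaf y = blockDist e y) :
    IsSmoothFoliation (fiber X p) l leaf := by
  have foliation : IsSmoothFoliation (fiber X p) (Module.finrank ℝ (Fin l → ℝ)) leaf :=
    isSmoothFoliation_of_tangentDist_eq realBlockScale_comm
      (fun y hy => realBlockScale_left_injective he hy.1)
      (fun y hy => by
        rw [tangentSet_fiber hy]
        rintro _ ⟨s, rfl⟩
        exact ⟨realCoeff e s, rfl⟩)
      tangent (fun y hy => by
        rw [hleaf y hy, accessibleSet_congr tangent, accessibleSet_fiber he hy])
  rwa [Module.finrank_fin_fun] at foliation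

theorem isKillingAt_realBlockScale_I (hz : z ∈ X.domain _) (s : Fin l → ℝ) :
    IsKillingAt X.metricCLM (realBlockScale Complex.I s) z := by
  refine isKillingAt_of_hasDerivAt (Φ := fun t =>
    (blockExp (t • realCoeff Complex.I s)).restrictScalars ℝ) (X.differentiableAt_metricCLM hz)
    ?_ ?_ fun t u v => ?_
  · rw [zero_smul, blockExp_zero]
    rfl
  · have flow_deriv := hasDerivAt_blockExp_smul (k := k) (realCoeff Complex.I s) 0
    rw [zero_smul, blockExp_zero, ContinuousLinearMap.comp_id] at flow_deriv
    exact (ContinuousLinearMap.restrictScalarsL ℂ (Cn k) (Cn k) ℝ ℝ).hasFDerivAt.comp_hasDerivAt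
      0 flow_deriv
  · obtain ⟨b, hb, flow_eq⟩ := exists_mem_Tk_smul_eq_blockExp (k := k) (t • s)
    simp only [map_smul] at flow_eq
    simp only [ContinuousLinearMap.coe_restrictScalars', ← flow_eq]
    exact X.metric_map (torusIsometry b hb.1)

theorem isLagrangianFrame_fiber (X : KahlerGeometry) (p : ProjProd k) :
    IsLagrangianFrame X.metric X.form (fiber X p) l orbitLeaf (perpLeaf X p) := by
  have metric_smooth : ∀ z ∈ fiber X p, DifferentiableAt ℝ X.metricCLM z :=
    fun z hz => X.differentiableAt_metricCLM hz.2.2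
  have foliationF : IsSmoothFoliation (fiber X p) l (perpLeaf X p) :=
    isSmoothFoliation_fiber one_ne_zero (fun _ => perpLeaf_eq_expLeaf)
      (fun _ => tangentDist_perpLeaf)
  have riemannianO : IsRiemannianFoliation X.metric (fiber X p) orbitLeaf :=
    isRiemannianFoliation_of_isKillingAt metric_smooth (fun z u v => X.metric_comm u v)
      (fun z hz => realBlockScale_left_injective Complex.I_ne_zero hz.1)
      (fun _ => tangentDist_orbitLeaf) (fun z hz => isKillingAt_realBlockScale_I hz.2.2)
  exact
    { foliationO := isSmoothFoliation_fiber Complex.I_ne_zero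
        (fun z hz => orbitLeaf_eq_expLeaf hz.2.2) (fun _ => tangentDist_orbitLeaf)
      foliationF
      lagrangianO := fun z hz => by
        rw [tangentDist_orbitLeaf hz]
        exact form_orthogonal_blockDist Complex.I_ne_zero hz
      lagrangianF := fun z hz => by
        rw [tangentDist_perpLeaf hz]
        exact form_orthogonal_blockDist one_ne_zero hz
      orthogonal := fun z hz u hu v hv => by
        rw [tangentDist_perpLeaf hz, ← normalDist_orbitLeaf hz] at hv
        exact hv.2 u hu
      riemannianO
      totallyGeodesicF := isTotallyGeodesicFoliation_of_isRiemannianFoliation metric_smooth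
        (fun z u v => X.metric_comm u v) riemannianO foliationF.involutive
        (fun z hz => (tangentDist_perpLeaf hz).trans (normalDist_orbitLeaf hz).symm)
        (fun z hz => (normalDist_perpLeaf hz).trans (tangentDist_orbitLeaf hz).symm) }

/-! ### The action of `𝕋ⁿ` on the fibers and their frames -/

theorem isRiemannianIsometryOn_smul (X : KahlerGeometry) (hb : b ∈ torus k) :
    IsRiemannianIsometryOn X.metric (VkU k X) (fun z => b • z) := by
  have mapsTo (a : CStar k) (ha : a ∈ torus k) :
      Set.MapsTo (fun z => a • z) (VkU k X) (VkU k X) := fun z hz =>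
    ⟨smul_mem_Vk a hz.1, (X.map_mem_domain_iff (torusIsometry a ha)).2 hz.2⟩
  let L : Cn k →L[ℝ] Cn k := (torusIsometry b hb).toContinuousLinearMap.restrictScalars ℝ
  refine ⟨?_, L.contDiff.contDiffOn, fun z _ u v => ?_⟩
  · exact Set.InvOn.bijOn ⟨fun z _ => inv_smul_smul b z, fun z _ => smul_inv_smul b z⟩
      (mapsTo b hb) (mapsTo b⁻¹ (inv_mem hb))
  · rw [show fderiv ℝ (fun z => b • z) z = L from L.fderiv]
    exact X.metric_map (torusIsometry b hb)

theorem smul_mem_fiber (hb : b ∈ torus k) (hz : z ∈ fiber X p) : b • z ∈ fiber X (b • p) := by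
  obtain ⟨hzV, rfl, hzX⟩ := hz
  exact ⟨smul_mem_Vk b hzV, rfl, (X.map_mem_domain_iff (torusIsometry b hb)).2 hzX⟩

theorem image_smul_fiber (X : KahlerGeometry) (p : ProjProd k) (hb : b ∈ torus k) :
    (fun z => b • z) '' fiber X p = fiber X (b • p) := by
  refine Set.Subset.antisymm (Set.image_subset_iff.2 fun z hz => smul_mem_fiber hb hz)
    fun w hw => ⟨b⁻¹ • w, ?_, smul_inv_smul b w⟩
  simpa only [inv_smul_smul] using smul_mem_fiber (inv_mem hb) hw

theorem image_smul_expLeaf (X : KahlerGeometry) (e : ℂ) (z : Cn k) (hb : b ∈ torus k) :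
    (fun w => b • w) '' expLeaf X e z = expLeaf X e (b • z) := by
  ext w
  constructor
  · rintro ⟨_, ⟨hw, s, rfl⟩, rfl⟩
    exact ⟨(X.map_mem_domain_iff (torusIsometry b hb)).2 hw, s, (smul_blockScale b _ z).symm⟩
  · rintro ⟨hw, s, rfl⟩
    refine ⟨blockExp (realCoeff e s) z, ⟨?_, s, rfl⟩, smul_blockScale b _ z⟩
    rw [blockExp, ← smul_blockScale] at hw
    exact (X.map_mem_domain_iff (torusIsometry b hb)).1 hw

theorem image_smul_orbitLeaf (hb : b ∈ torus k) (hz : z ∈ fiber X p) :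
    (fun w => b • w) '' orbitLeaf z = orbitLeaf (b • z) := by
  rw [orbitLeaf_eq_expLeaf hz.2.2, orbitLeaf_eq_expLeaf (smul_mem_fiber hb hz).2.2,
    image_smul_expLeaf X _ z hb]

theorem image_smul_perpLeaf (hb : b ∈ torus k) (hz : z ∈ fiber X p) :
    (fun w => b • w) '' perpLeaf X p z = perpLeaf X (b • p) (b • z) := by
  rw [perpLeaf_eq_expLeaf hz, perpLeaf_eq_expLeaf (smul_mem_fiber hb hz),
    image_smul_expLeaf X _ z hb]

end LagrangianFrame

theorem mainTheorem8_general {l : ℕ} (k : Fin l → ℕ) :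
    IsHolomorphicPrincipalBundle 𝓘(ℂ, Cn k) (projProdModel k) (groupModel l) (Fin l → ℂˣ)
      (projPi k) ∧
    (∀ b : CStar k, IsPrincipalBundleAutomorphism 𝓘(ℂ, Cn k) (projProdModel k) (Fin l → ℂˣ)
      (projPi k) (fun z => b • z) (fun p => b • p)) ∧
    ∀ X : KahlerGeometry,
      (∀ p : ProjProd k, IsComplexSubmanifold l (fiber X p) ∧
        IsLagrangianFrame X.metric X.form (fiber X p) l orbitLeaf (perpLeaf X p)) ∧
      ∀ b ∈ torus k,
        IsRiemannianIsometryOn X.metric (VkU k X) (fun z => b • z) ∧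
        ∀ p : ProjProd k,
          (fun z => b • z) '' fiber X p = fiber X (b • p) ∧
          ∀ z ∈ fiber X p,
            (fun w => b • w) '' orbitLeaf z = orbitLeaf (b • z) ∧
            (fun w => b • w) '' perpLeaf X p z = perpLeaf X (b • p) (b • z) := by
  refine ⟨isHolomorphicPrincipalBundle_projPi, isPrincipalBundleAutomorphism_smul, fun X => ?_⟩
  refine ⟨fun p => ⟨isComplexSubmanifold_fiber X p, isLagrangianFrame_fiber X p⟩, fun b hb => ?_⟩
  refine ⟨isRiemannianIsometryOn_smul X hb, fun p => ⟨image_smul_fiber X p hb, fun z hz => ?_⟩⟩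
  exact ⟨image_smul_orbitLeaf hb hz, image_smul_perpLeaf hb hz⟩

theorem mainTheorem8 {l : ℕ} (k : Fin l → ℕ) (hk : ∀ j, 0 < k j) :
    -- `π_k : V_k → ∏_j ℙ^{k_j - 1}(ℂ)` is a principal bundle with group `A_k ≅ (ℂ*)^l`,
    IsHolomorphicPrincipalBundle 𝓘(ℂ, Cn k) (projProdModel k) (groupModel l) (Fin l → ℂˣ)
      (projPi k) ∧
    -- and the elements of `B_k` act on it by principal bundle automorphisms.
    (∀ b ∈ Bk k, IsPrincipalBundleAutomorphism 𝓘(ℂ, Cn k) (projProdModel k) (Fin l → ℂˣ)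
      (projPi k) (fun z => b • z) (fun p => b • p)) ∧
    ∀ X : KahlerGeometry,
      -- The `T_k`-orbits and their orthogonal foliation form a Lagrangian frame of each fiber;
      (∀ p : ProjProd k, IsComplexSubmanifold l (fiber X p) ∧
        IsLagrangianFrame X.metric X.form (fiber X p) l orbitLeaf (perpLeaf X p)) ∧
      ∀ b ∈ torus k ⊓ Bk k,
        -- `𝕋ⁿ ∩ B_k` acts isometrically on `V_k ∩ 𝕌ⁿ`,
        IsRiemannianIsometryOn X.metric (VkU k X) (fun z => b • z) ∧
        -- and it permutes the fibers and their Lagrangian frames.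
        ∀ p : ProjProd k,
          (fun z => b • z) '' fiber X p = fiber X (b • p) ∧
          ∀ z ∈ fiber X p,
            (fun w => b • w) '' orbitLeaf z = orbitLeaf (b • z) ∧
            (fun w => b • w) '' perpLeaf X p z = perpLeaf X (b • p) (b • z) := by
  obtain ⟨bundle, automorphism, frame⟩ := mainTheorem8_general k
  exact ⟨bundle, fun b _ => automorphism b, fun X => ⟨(frame X).1, fun b hb => (frame X).2 b hb.1⟩⟩
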